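/- Let $\Gamma$ be a quantum graph: a finite graph with vertex set $V$ and edge set $E$, without loops, whose edges $e$ are identified with segments $[0,l_e]$, $l_e>0$, with a boundary condition $A_v f|_v+B_v f'|_v=0$ at each vertex $v$, where $f|_v$ and $f'|_v$ are the vectors of values and of outgoing derivatives of $f$ at $v$ along the edges in the set $E_v$ of edges incident to $v$. Its Laplacian is the operator $f\mapsto -f''$ in $L^2(\Gamma)=\bigoplus_e L^2([0,l_e])$ on the domain of all $f\in W^{2,2}(\Gamma)$ that satisfy the boundary conditions. Let a finite group $G$ act on $\Gamma$ (preserving incidence, lengths and boundary conditions), carrying no vertex to one of its neighbours, and let $R$ be a complex representation of $G$ of finite dimension $d$, with homomorphism $\rho_R$ and character $\chi_R$. Write $G_{\tilde v}$, $G_{\tilde e}$ for stabilizers. The quotient quantum graph $\Gamma/R$ is constructed from the following choices. Choose representatives $\tilde e^i$ ($1\le i\le I$) of the orbits of edges and $\tilde v_k$ ($1\le k\le K$) of the orbits of vertices, a basis $B$ of $R$, and for each $i$ a basis $B^i=(b^i_1,\dots,b^i_d)$ of $R$ whose first $d_i$ vectors form a basis of the trivial component of $\mathrm{Res}_{G_{\tilde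 e^i}}R$ and whose other vectors lie in the sum of the nontrivial irreducible subrepresentations of $\mathrm{Res}_{G_{\tilde e^i}}R$. The vertices of $\Gamma/R$ are $v_1,\dots,v_K$; its edges are $e^i_j$ ($1\le i\le I$, $1\le j\le d_i$), where $e^i_j$ has length $l_{\tilde e^i}$ and joins the vertices that correspond to the orbits of the ends of $\tilde e^i$. To define the boundary condition at $v_k$, write $E_{\tilde v_k}=\{g_1\tilde e^{\nu_1},\dots,g_n\tilde e^{\nu_n}\}$ with $g_l\in G$ and put $$A_{v_k}=(A_{\tilde v_k}\otimes I_d)\,D\,\Theta,\quad B_{v_k}=(B_{\tilde v_k}\otimes I_d)\,D\,\Theta,\quad D=\mathrm{diag}\big([\rho_R(g_1^{-1})]_{B^{\nu_1}}^{B},\dots,[\rho_R(g_n^{-1})]_{B^{\nu_n}}^{B}\big)^T,$$ where $[T]^{C}_{C'}$ is the matrix of $T$ from the basis $C$ (source) to the basis $C'$ (target), and $\Theta$ is the $0/1$ matrix whose entry in row $(l,a)$ ($1\le l\le n$, $1\le a\le d$) and in the column of the edge $e^i_j$ incident to $v_k$ is $1$ exactly if $\nu_l=i$ and $a=j$. (Linearly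 dependent rows of $(A_{v_k}\,B_{v_k})$ may be dropped; this does not change the condition.) Assume that $[\rho_R(g)]_B^{B^i}$ is unitary for all $g\in G$ and $1\le i\le I$. 1. If the Laplacian of $\Gamma$ is self-adjoint and $G$ acts freely both on the edges and on the vertices of $\Gamma$, then the Laplacian of $\Gamma/R$ is self-adjoint. 2. If $\Gamma$ has Neumann boundary conditions (at each vertex, the values along the incident edges agree and the outgoing derivatives sum to $0$), then the Laplacian of $\Gamma/R$ is self-adjoint if and only if for every vertex $\tilde v$ of $\Gamma$ at least one of the following holds: (a) $\langle\chi_R,\mathbf 1\rangle_{G_{\tilde v}}=\frac1{|G_{\tilde v}|}\sum_{g\in G_{\tilde v}}\chi_R(g)=0$, that is, $\mathrm{Res}_{G_{\tilde v}}R$ has no trivial component; (b) all stabilizers $G_{\tilde e}$, $\tilde e\in E_{\tilde v}$, have equal order. -/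

import Mathlib

open MeasureTheory
open scoped Matrix Kronecker ComplexConjugate

noncomputable section

/-- A finite metric graph without loops (parallel edges are allowed): every edge `e` is identified
with the segment `[0, len e]`, the point `0` being its end `src e` and the point `len e` its end
`tgt e`. -/
structure MetricGraph (V E : Type*) where
  src : E → V
  tgt : E → V
  src_ne_tgt : ∀ e, src e ≠ tgt e
  len : E → ℝ
  len_pos : ∀ e, 0 < len e

namespace MetricGraph

variable {V E : Type*} (Γ : MetricGraph V E)

/-- The set `E_v` of edges incident to the vertex `v`. -/
def Inc (v : V) : Type _ := {e : E // Γ.src e = v ∨ Γ.tgt e = v}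

instance (v : V) [Finite E] : Finite (Γ.Inc v) := inferInstanceAs (Finite {e : E // Γ.src e = v ∨ Γ.tgt e = v})

instance (v : V) [Finite E] : Fintype (Γ.Inc v) := Fintype.ofFinite _

instance (v : V) : DecidableEq (Γ.Inc v) := Classical.decEq _

/-- The Hilbert space `L²(Γ) = ⨁ₑ L²([0, len e])`. -/
abbrev L2 : Type _ :=
  PiLp 2 fun e : E => Lp ℂ 2 ((volume : Measure ℝ).restrict (Set.Icc 0 (Γ.len e)))

open Classical in
/-- The value `u|_e (v)` at the vertex `v` of a function on the edge `e ∈ E_v`. -/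
def vertexValue (u : E → ℝ → ℂ) (v : V) (e : E) : ℂ :=
  if Γ.src e = v then u e 0 else u e (Γ.len e)

open Classical in
/-- The outgoing derivative at the vertex `v` along the edge `e ∈ E_v`; here `u'` is the derivative
with respect to the coordinate of the edge. -/
def outgoingDeriv (u' : E → ℝ → ℂ) (v : V) (e : E) : ℂ :=
  if Γ.src e = v then u' e 0 else -u' e (Γ.len e)

/-- `f ∈ W^{2,2}(Γ)` with `-f'' = h`: on each edge `f` has a continuously differentiable
representative `u`, whose derivative `u'` is absolutely continuous with derivative `-h ∈ L²`. -/
structure IsW22 [Fintype E] (f h : Γ.L2) (u u' : E → ℝ → ℂ) : Prop where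
  ae_eq : ∀ e, f e =ᵐ[volume.restrict (Set.Icc 0 (Γ.len e))] u e
  deriv_eq : ∀ e, ∀ x ∈ Set.Icc 0 (Γ.len e),
    HasDerivWithinAt (u e) (u' e x) (Set.Icc 0 (Γ.len e)) x
  deriv_deriv_eq : ∀ e, ∀ x ∈ Set.Icc 0 (Γ.len e), u' e x = u' e 0 + ∫ t in (0 : ℝ)..x, -(h e t)

end MetricGraph

/-- A quantum graph: a metric graph with homogeneous conditions `A_v f|_v + B_v f'|_v = 0` at its
vertices. The columns of `A_v` and `B_v` are indexed by `E_v`. The rows may be indexed by any finite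
type (square matrices are a special case), as conditions may be linearly dependent. -/
structure QuantumGraph (V E : Type*) extends MetricGraph V E where
  Row : V → Type
  rowFintype : ∀ v, Fintype (Row v)
  A : ∀ v, Matrix (Row v) (toMetricGraph.Inc v) ℂ
  B : ∀ v, Matrix (Row v) (toMetricGraph.Inc v) ℂ

namespace QuantumGraph

variable {V E : Type*} [Fintype E] (Γ : QuantumGraph V E)

instance (v : V) : Fintype (Γ.Row v) := Γ.rowFintype v

/-- The boundary condition at `v`, for the values `x` and the outgoing derivatives `y` along the
edges incident to `v` (the other entries of `x` and `y` play no role). -/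
def BC (v : V) (x y : E → ℂ) : Prop :=
  Γ.A v *ᵥ (fun e : Γ.Inc v => x e.1) + Γ.B v *ᵥ (fun e : Γ.Inc v => y e.1) = 0

variable {Γ} in
theorem BC.zero (v : V) : Γ.BC v (fun _ => 0) (fun _ => 0) := by
  have h : (fun _ : Γ.Inc v => (0 : ℂ)) = 0 := rfl
  simp [BC, h]

variable {Γ} in
theorem BC.add {v : V} {x y x₁ y₁ : E → ℂ} (h : Γ.BC v x y) (h₁ : Γ.BC v x₁ y₁) :
    Γ.BC v (x + x₁) (y + y₁) := by
  have e₁ : (fun e : Γ.Inc v => (x + x₁) e.1)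
      = (fun e : Γ.Inc v => x e.1) + (fun e : Γ.Inc v => x₁ e.1) := rfl
  have e₂ : (fun e : Γ.Inc v => (y + y₁) e.1)
      = (fun e : Γ.Inc v => y e.1) + (fun e : Γ.Inc v => y₁ e.1) := rfl
  unfold BC at *
  rw [e₁, e₂, Matrix.mulVec_add, Matrix.mulVec_add, add_add_add_comm, h, h₁, add_zero]

variable {Γ} in
theorem BC.smul {v : V} {x y : E → ℂ} (c : ℂ) (h : Γ.BC v x y) :
    Γ.BC v (c • x) (c • y) := by
  have e₁ : (fun e : Γ.Inc v => (c • x) e.1) = c • (fun e : Γ.Inc v => x e.1) := rfl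
  have e₂ : (fun e : Γ.Inc v => (c • y) e.1) = c • (fun e : Γ.Inc v => y e.1) := rfl
  unfold BC at *
  rw [e₁, e₂, Matrix.mulVec_smul, Matrix.mulVec_smul, ← smul_add, h, smul_zero]

theorem intervalIntegrable_coe {l x : ℝ} (hx : x ∈ Set.Icc 0 l)
    (h : Lp ℂ 2 ((volume : Measure ℝ).restrict (Set.Icc 0 l))) :
    IntervalIntegrable h volume 0 x := by
  have h1 : IntegrableOn h (Set.Icc 0 l) volume :=
    (Lp.memLp h).integrable (by norm_num)
  rw [intervalIntegrable_iff_integrableOn_Icc_of_le hx.1]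
  exact h1.mono_set (Set.Icc_subset_Icc_right hx.2)

/-- The graph `{(f, -f'')}` of the negative Laplacian on the functions in `W^{2,2}(Γ)` which satisfy
the boundary conditions at all vertices. -/
def laplacianGraph : Submodule ℂ (Γ.L2 × Γ.L2) where
  carrier := {p | ∃ u u' : E → ℝ → ℂ, Γ.IsW22 p.1 p.2 u u' ∧
    ∀ v, Γ.BC v (Γ.vertexValue u v) (Γ.outgoingDeriv u' v)}
  zero_mem' := by
    refine ⟨fun _ _ => 0, fun _ _ => 0, ⟨fun e => ?_, fun e x _ => ?_, fun e x hx => ?_⟩,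
      fun v => ?_⟩
    · exact Lp.coeFn_zero _ _ _
    · exact hasDerivWithinAt_const _ _ _
    · have h0 : ((0 : Γ.L2 × Γ.L2).2 e : ℝ → ℂ)
          =ᵐ[volume.restrict (Set.Icc 0 (Γ.len e))] 0 := Lp.coeFn_zero _ _ _
      have h1 : ∫ t in (0 : ℝ)..x, -((0 : Γ.L2 × Γ.L2).2 e t) = 0 := by
        apply intervalIntegral.integral_zero_ae
        have h2 := (ae_restrict_iff' measurableSet_Icc).1 h0
        filter_upwards [h2] with t ht htx
        rw [Set.uIoc_of_le hx.1] at htx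
        rw [ht ⟨htx.1.le, htx.2.trans hx.2⟩]; simp
      rw [h1]; simp
    · have e₁ : Γ.vertexValue (fun _ _ => 0) v = fun _ => 0 := by
        funext e; simp [MetricGraph.vertexValue]
      have e₂ : Γ.outgoingDeriv (fun _ _ => 0) v = fun _ => 0 := by
        funext e; simp [MetricGraph.outgoingDeriv]
      rw [e₁, e₂]; exact BC.zero v
  add_mem' := by
    rintro p q ⟨u, u', hu, hb⟩ ⟨w, w', hw, hc⟩
    refine ⟨u + w, u' + w', ⟨fun e => ?_, fun e x hx => ?_, fun e x hx => ?_⟩, fun v => ?_⟩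
    · exact (Lp.coeFn_add (p.1 e) (q.1 e)).trans ((hu.ae_eq e).add (hw.ae_eq e))
    · exact (hu.deriv_eq e x hx).add (hw.deriv_eq e x hx)
    · have h0 : ((p + q).2 e : ℝ → ℂ) =ᵐ[volume.restrict (Set.Icc 0 (Γ.len e))]
          (p.2 e : ℝ → ℂ) + (q.2 e : ℝ → ℂ) := Lp.coeFn_add _ _
      have h1 : ∫ t in (0 : ℝ)..x, -((p + q).2 e t)
          = ∫ t in (0 : ℝ)..x, (-(p.2 e t) + -(q.2 e t)) := by
        apply intervalIntegral.integral_congr_ae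
        have h2 := (ae_restrict_iff' measurableSet_Icc).1 h0
        filter_upwards [h2] with t ht htx
        rw [Set.uIoc_of_le hx.1] at htx
        rw [ht ⟨htx.1.le, htx.2.trans hx.2⟩]; simp [add_comm]
      rw [h1, intervalIntegral.integral_add (f := fun t => -(p.2 e t)) (g := fun t => -(q.2 e t))
        (intervalIntegrable_coe hx _).neg (intervalIntegrable_coe hx _).neg]
      simp only [Pi.add_apply, hu.deriv_deriv_eq e x hx, hw.deriv_deriv_eq e x hx]
      ring
    · have e₁ : Γ.vertexValue (u + w) v = Γ.vertexValue u v + Γ.vertexValue w v := by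
        funext e; simp only [MetricGraph.vertexValue, Pi.add_apply]; split_ifs <;> rfl
      have e₂ : Γ.outgoingDeriv (u' + w') v = Γ.outgoingDeriv u' v + Γ.outgoingDeriv w' v := by
        funext e; simp only [MetricGraph.outgoingDeriv, Pi.add_apply]; split_ifs <;> ring
      rw [e₁, e₂]; exact (hb v).add (hc v)
  smul_mem' := by
    rintro c p ⟨u, u', hu, hb⟩
    refine ⟨c • u, c • u', ⟨fun e => ?_, fun e x hx => ?_, fun e x hx => ?_⟩, fun v => ?_⟩
    · exact (Lp.coeFn_smul c (p.1 e)).trans ((hu.ae_eq e).const_smul c)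
    · exact (hu.deriv_eq e x hx).const_smul c
    · have h0 : ((c • p).2 e : ℝ → ℂ) =ᵐ[volume.restrict (Set.Icc 0 (Γ.len e))]
          c • (p.2 e : ℝ → ℂ) := Lp.coeFn_smul _ _
      have h1 : ∫ t in (0 : ℝ)..x, -((c • p).2 e t) = ∫ t in (0 : ℝ)..x, c * -(p.2 e t) := by
        apply intervalIntegral.integral_congr_ae
        have h2 := (ae_restrict_iff' measurableSet_Icc).1 h0
        filter_upwards [h2] with t ht htx
        rw [Set.uIoc_of_le hx.1] at htx
        rw [ht ⟨htx.1.le, htx.2.trans hx.2⟩]; simp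
      rw [h1, intervalIntegral.integral_const_mul]
      simp only [Pi.smul_apply, smul_eq_mul, hu.deriv_deriv_eq e x hx]
      ring
    · have e₁ : Γ.vertexValue (c • u) v = c • Γ.vertexValue u v := by
        funext e; simp only [MetricGraph.vertexValue, Pi.smul_apply]; split_ifs <;> rfl
      have e₂ : Γ.outgoingDeriv (c • u') v = c • Γ.outgoingDeriv u' v := by
        funext e; simp only [MetricGraph.outgoingDeriv, Pi.smul_apply, smul_eq_mul]
        split_ifs <;> ring
      rw [e₁, e₂]; exact (hb v).smul c

/-- `-f''` is determined by `f`. -/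
theorem laplacianGraph_functional (p : Γ.L2 × Γ.L2) (hp : p ∈ Γ.laplacianGraph)
    (h0 : p.1 = 0) : p.2 = 0 := by
  obtain ⟨u, u', hu, -⟩ := hp
  ext1 e
  have hl := Γ.len_pos e
  have hf : (fun _ : ℝ => (0 : ℂ)) =ᵐ[volume.restrict (Set.Icc 0 (Γ.len e))] u e := by
    refine Filter.EventuallyEq.trans ?_ (hu.ae_eq e)
    rw [h0]
    exact (Lp.coeFn_zero _ _ _).symm
  have hu0 : Set.EqOn (fun _ : ℝ => (0 : ℂ)) (u e) (Set.Icc 0 (Γ.len e)) :=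
    Measure.eqOn_Icc_of_ae_eq volume hl.ne hf continuousOn_const
      (fun x hx => (hu.deriv_eq e x hx).continuousWithinAt)
  have hu1 : ∀ x ∈ Set.Icc 0 (Γ.len e), u' e x = 0 := fun x hx =>
    (uniqueDiffOn_Icc hl x hx).eq_deriv _ (hu.deriv_eq e x hx)
      ((hasDerivWithinAt_const x _ (0 : ℂ)).congr (fun y hy => (hu0 hy).symm) (hu0 hx).symm)
  have hint : ∀ x ∈ Set.Icc 0 (Γ.len e), ∫ t in (0 : ℝ)..x, p.2 e t = 0 := fun x hx => by
    have := hu.deriv_deriv_eq e x hx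
    rw [hu1 x hx, hu1 0 ⟨le_rfl, hl.le⟩, zero_add, intervalIntegral.integral_neg] at this
    exact neg_eq_zero.1 this.symm
  have hl' : Γ.len e ∈ Set.Icc 0 (Γ.len e) := ⟨hl.le, le_rfl⟩
  have hae := (intervalIntegrable_coe hl' (p.2 e)).ae_hasDerivAt_integral
  refine (Lp.eq_zero_iff_ae_eq_zero (f := p.2 e)).2 ?_
  have hm : ae ((volume : Measure ℝ).restrict (Set.Ioo 0 (Γ.len e)))
      = ae (volume.restrict (Set.Icc 0 (Γ.len e))) := by
    rw [Measure.restrict_congr_set Ioo_ae_eq_Icc]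
  rw [Filter.EventuallyEq, ← hm]
  refine (ae_restrict_iff' measurableSet_Ioo).2 ?_
  filter_upwards [hae] with x hx hxI
  have hd := hx (by rw [Set.uIcc_of_le hl.le]; exact Set.Ioo_subset_Icc_self hxI) 0
    (by rw [Set.uIcc_of_le hl.le]; exact ⟨le_rfl, hl.le⟩)
  refine hd.unique ((hasDerivAt_const x (0 : ℂ)).congr_of_eventuallyEq ?_)
  filter_upwards [Ioo_mem_nhds hxI.1 hxI.2] with y hy
  exact hint y (Set.Ioo_subset_Icc_self hy)

/-- The negative Laplacian `f ↦ -f''` of the quantum graph, as an unbounded operator on `L²(Γ)`. -/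
def laplacian : Γ.L2 →ₗ.[ℂ] Γ.L2 := Γ.laplacianGraph.toLinearPMap

theorem laplacian_graph : Γ.laplacian.graph = Γ.laplacianGraph :=
  Γ.laplacianGraph.toLinearPMap_graph_eq Γ.laplacianGraph_functional

/-- Neumann (Kirchhoff) conditions at all vertices: the values along the edges at `v` agree, and the
outgoing derivatives sum to zero. -/
def IsNeumann : Prop :=
  ∀ v (x y : E → ℂ), Γ.BC v x y ↔
    (∀ e e' : Γ.Inc v, x e.1 = x e'.1) ∧ ∑ e : Γ.Inc v, y e.1 = 0

/-- The action of `G` on the vertices and edges is an action on the quantum graph: it preserves the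
connectivity, the lengths and the boundary conditions; moreover no vertex is carried to one of its
neighbours. -/
structure IsAction (G : Type*) [Group G] [MulAction G V] [MulAction G E] : Prop where
  ends : ∀ (g : G) (e : E),
    s(Γ.src (g • e), Γ.tgt (g • e)) = s(g • Γ.src e, g • Γ.tgt e)
  len_smul : ∀ (g : G) (e : E), Γ.len (g • e) = Γ.len e
  bc_smul : ∀ (g : G) (v : V) (x y : E → ℂ),
    Γ.BC v x y ↔ Γ.BC (g • v) (fun e => x (g⁻¹ • e)) (fun e => y (g⁻¹ • e))
  smul_src_ne_tgt : ∀ (g : G) (e : E), g • Γ.src e ≠ Γ.tgt e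

end QuantumGraph

section Rep

variable {G W : Type*} [Group G] [AddCommGroup W] [Module ℂ W] (ρ : Representation ℂ G W)

/-- The restriction of a representation to a subgroup. -/
abbrev resRep (H : Subgroup G) : Representation ℂ H W := ρ.comp H.subtype

/-- The sum of all subrepresentations that are irreducible and not trivial: the complement of the
trivial component in the isotypic decomposition. -/
def nontrivialPart : Submodule ℂ W :=
  ⨆ (U : Subrepresentation ρ) (_ : U.toRepresentation.IsIrreducible)
    (_ : ¬ U.toRepresentation.IsTrivial), U.toSubmodule

/-- `⟨χ, ψ⟩_H = |H|⁻¹ ∑_{h ∈ H} χ(h) conj (ψ(h))`. -/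
def charInner (H : Subgroup G) (χ ψ : G → ℂ) : ℂ :=
  (Nat.card H : ℂ)⁻¹ * ∑ᶠ h : H, χ h * conj (ψ h)

end Rep

/-- The choices made in the construction of `Γ/R`: representatives of the orbits of edges and of
vertices; for each edge `e` at the representative `k` of a vertex orbit an element of `G` that
carries the representative of the orbit of `e` to `e`; a basis `b` of the representation; and for
each edge representative `ẽⁱ` a basis `bE i`, whose first `dᵢ` vectors form a basis of the trivial
component of the restriction to the stabilizer of `ẽⁱ` and whose other vectors lie in the
complement. -/
structure QuotientChoice {V E G W : Type*} [Group G] [MulAction G V] [MulAction G E]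
    [AddCommGroup W] [Module ℂ W] (Γ : QuantumGraph V E) (ρ : Representation ℂ G W) (d : ℕ) where
  edgeRep : MulAction.orbitRel.Quotient G E → E
  edgeRep_spec : ∀ i, (Quotient.mk'' (edgeRep i) : MulAction.orbitRel.Quotient G E) = i
  vertRep : MulAction.orbitRel.Quotient G V → V
  vertRep_spec : ∀ k, (Quotient.mk'' (vertRep k) : MulAction.orbitRel.Quotient G V) = k
  trans : ∀ k, Γ.Inc (vertRep k) → G
  trans_spec : ∀ k (e : Γ.Inc (vertRep k)), trans k e • edgeRep (Quotient.mk'' e.1) = e.1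
  b : Module.Basis (Fin d) ℂ W
  bE : MulAction.orbitRel.Quotient G E → Module.Basis (Fin d) ℂ W
  bE_mem_invariants : ∀ i (j : Fin d),
    (j : ℕ) < Module.finrank ℂ (resRep ρ (MulAction.stabilizer G (edgeRep i))).invariants →
      bE i j ∈ (resRep ρ (MulAction.stabilizer G (edgeRep i))).invariants
  bE_mem_nontrivialPart : ∀ i (j : Fin d),
    Module.finrank ℂ (resRep ρ (MulAction.stabilizer G (edgeRep i))).invariants ≤ (j : ℕ) →
      bE i j ∈ nontrivialPart (resRep ρ (MulAction.stabilizer G (edgeRep i)))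

namespace QuotientChoice

variable {V E G W : Type*} [Group G] [MulAction G V] [MulAction G E]
    [AddCommGroup W] [Module ℂ W] {Γ : QuantumGraph V E} {ρ : Representation ℂ G W} {d : ℕ}
    (Q : QuotientChoice Γ ρ d)

/-- The number `dᵢ` of copies of `ẽⁱ` in the quotient. -/
def edgeDim (i : MulAction.orbitRel.Quotient G E) : ℕ :=
  Module.finrank ℂ (resRep ρ (MulAction.stabilizer G (Q.edgeRep i))).invariants

/-- The edges `eⁱⱼ`, `j < dᵢ`, of the quotient. -/
def Edge : Type _ := Σ i : MulAction.orbitRel.Quotient G E, {j : Fin d // (j : ℕ) < Q.edgeDim i}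

instance [Finite E] : Finite Q.Edge :=
  haveI : Finite (MulAction.orbitRel.Quotient G E) := Quotient.finite _
  inferInstanceAs
    (Finite (Σ i : MulAction.orbitRel.Quotient G E, {j : Fin d // (j : ℕ) < Q.edgeDim i}))

instance [Finite E] : Fintype Q.Edge := Fintype.ofFinite _

variable [Fintype E] (hG : Γ.IsAction G)

/-- The metric graph underlying `Γ/R`. -/
def metricQuotient : MetricGraph (MulAction.orbitRel.Quotient G V) Q.Edge where
  src e := Quotient.mk'' (Γ.src (Q.edgeRep e.1))
  tgt e := Quotient.mk'' (Γ.tgt (Q.edgeRep e.1))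
  src_ne_tgt e h := by
    obtain ⟨g, hg⟩ := Quotient.eq''.1 h.symm
    exact hG.smul_src_ne_tgt g _ hg
  len e := Γ.len (Q.edgeRep e.1)
  len_pos e := Γ.len_pos _

open Classical in
/-- The matrix `Θ`: the incidence matrix between the edges at `ṽ_k` (times `d`) and the edges of the
quotient at `v_k`, without the columns of the copies that do not exist. -/
def Theta (k : MulAction.orbitRel.Quotient G V) :
    Matrix (Γ.Inc (Q.vertRep k) × Fin d) ((Q.metricQuotient hG).Inc k) ℂ :=
  Matrix.of fun p e =>
    if (Quotient.mk'' p.1.1 : MulAction.orbitRel.Quotient G E) = e.1.1 ∧ p.2 = e.1.2.1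
    then 1 else 0

/-- The matrix `diag ([ρ(g₁⁻¹)], …, [ρ(gₙ⁻¹)])ᵀ`, where `[ρ(g_l⁻¹)]` is taken with respect to `b`
in the source and to the basis of the orbit of the `l`-th edge in the target. -/
def diagRep (k : MulAction.orbitRel.Quotient G V) :
    Matrix (Γ.Inc (Q.vertRep k) × Fin d) (Γ.Inc (Q.vertRep k) × Fin d) ℂ :=
  ((Matrix.blockDiagonal fun e : Γ.Inc (Q.vertRep k) =>
      LinearMap.toMatrix Q.b (Q.bE (Quotient.mk'' e.1)) (ρ (Q.trans k e)⁻¹)).submatrix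
    Prod.swap Prod.swap)ᵀ

/-- The quotient quantum graph `Γ/R`. -/
def quotient : QuantumGraph (MulAction.orbitRel.Quotient G V) Q.Edge where
  toMetricGraph := Q.metricQuotient hG
  Row k := Γ.Row (Q.vertRep k) × Fin d
  rowFintype _ := inferInstance
  A k := (Γ.A (Q.vertRep k) ⊗ₖ (1 : Matrix (Fin d) (Fin d) ℂ)) * Q.diagRep k * Q.Theta hG k
  B k := (Γ.B (Q.vertRep k) ⊗ₖ (1 : Matrix (Fin d) (Fin d) ℂ)) * Q.diagRep k * Q.Theta hG k

end QuotientChoice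

end

/-! Self-adjointness is local. Integration by parts turns ⟨-f'', g⟩ - ⟨f, -g''⟩ into a sum over the
vertices of the boundary form ∑ₑ (conj y'ₑ xₑ - conj x'ₑ yₑ) in values and outgoing derivatives. All
boundary data occur, and the domain of the adjoint still lies in W^{2,2}. So the Laplacian is
self-adjoint iff the condition at each vertex is its own orthogonal for this form
(`isSelfAdjoint_laplacian_iff`).

At v_k, values on the quotient edges amount to functionals ψₑ on R, one for each edge e at ṽ_k, with
ψ_{ge} ∘ ρ(g) = ψₑ (`isEquivariant_lift`, `exists_lift_eq`); the dᵢ copies of an edge suffice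
because an invariant functional is determined by its restriction to the trivial component. The
condition at v_k asks that for every a the numbers ψₑ(b_a) satisfy the condition of Γ
(`bc_quotient_iff`). By unitarity the quotient's form is the sum over e of the terms for ψₑ with
weight 1/mₑ, where mₑ counts the edges at ṽ_k in the orbit of e (`boundaryForm_quotient`).

If G_ṽ is trivial, equivariance is void and all mₑ = 1, so the condition consists of d copies of
that of Γ. For Neumann conditions the values form a constant family φ, with φ invariant under G_ṽ,
and the derivatives a family χ with ∑ χₑ = 0. Without nonzero invariant φ this is the Dirichlet
condition, which is Lagrangian. Otherwise the orthogonal of the constant families is given by ∑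
χₑ/mₑ = 0, which agrees with ∑ χₑ = 0 exactly if all mₑ are equal; and mₑ |Gₑ| = |G_ṽ| by
orbit-stabilizer. -/

noncomputable section

namespace QuantumGraph

/-! ### Integration by parts on an interval -/

section Interval

theorem integral_eq_sub_of_hasDerivWithinAt_Icc {s t l : ℝ} {a a' : ℝ → ℂ}
    (ha : ∀ x ∈ Set.Icc 0 l, HasDerivWithinAt a (a' x) (Set.Icc 0 l) x)
    (ha' : ContinuousOn a' (Set.Icc 0 l)) (hs : 0 ≤ s) (hst : s ≤ t) (ht : t ≤ l) :
    ∫ x in s..t, a' x = a t - a s := by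
  have hsub : Set.Icc s t ⊆ Set.Icc 0 l := Set.Icc_subset_Icc hs ht
  refine intervalIntegral.integral_eq_sub_of_hasDerivAt_of_le hst
    (fun x hx => ((ha x (hsub hx)).continuousWithinAt).mono hsub) (fun x hx => ?_) ?_
  · have hx' : x ∈ Set.Ioo 0 l := ⟨hs.trans_lt hx.1, hx.2.trans_le ht⟩
    exact (ha x (Set.Ioo_subset_Icc_self hx')).hasDerivAt (Icc_mem_nhds hx'.1 hx'.2)
  · apply ContinuousOn.intervalIntegrable
    rw [Set.uIcc_of_le hst]
    exact ha'.mono hsub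

/-- Fubini for a'(x) k(t) on the triangle t ≤ x. Only integrability of k is needed, so that k may be
a second derivative in L². -/
theorem integral_mul_primitive_eq {l : ℝ} (hl : 0 ≤ l) {a a' k : ℝ → ℂ}
    (ha : ∀ x ∈ Set.Icc 0 l, HasDerivWithinAt a (a' x) (Set.Icc 0 l) x)
    (ha' : ContinuousOn a' (Set.Icc 0 l)) (hk : IntervalIntegrable k volume 0 l) :
    ∫ x in (0 : ℝ)..l, a' x * ∫ t in (0 : ℝ)..x, k t
      = ∫ t in (0 : ℝ)..l, (a l - a t) * k t := by
  have hai : IntegrableOn a' (Set.Ioc 0 l) :=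
    (ha'.integrableOn_compact isCompact_Icc).mono_set Set.Ioc_subset_Icc_self
  have hki : IntegrableOn k (Set.Ioc 0 l) :=
    (intervalIntegrable_iff_integrableOn_Ioc_of_le hl).1 hk
  let F : ℝ → ℝ → ℂ := fun x t => {p : ℝ × ℝ | p.2 ≤ p.1}.indicator
    (fun p => a' p.1 * k p.2) (x, t)
  have hF : Integrable (Function.uncurry F)
      ((volume.restrict (Set.Ioc 0 l)).prod (volume.restrict (Set.Ioc 0 l))) :=
    (hai.mul_prod hki).indicator (measurableSet_le measurable_snd measurable_fst)
  have hswap := integral_integral_swap hF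
  rw [intervalIntegral.integral_of_le hl, intervalIntegral.integral_of_le hl]
  convert hswap using 1
  · refine setIntegral_congr_fun measurableSet_Ioc fun x hx => ?_
    have h1 : ∀ t, F x t = (Set.Iic x).indicator (fun t => a' x * k t) t := fun t => by
      by_cases h : t ≤ x <;> simp [F, Set.indicator, h]
    simp only [h1]
    rw [setIntegral_indicator measurableSet_Iic, Set.Ioc_inter_Iic, min_eq_right hx.2,
      intervalIntegral.integral_of_le hx.1.le, integral_const_mul]
  · refine setIntegral_congr_fun measurableSet_Ioc fun t ht => ?_
    have h1 : ∀ x, F x t = (Set.Ici t).indicator (fun x => a' x * k t) x := fun x => by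
      by_cases h : t ≤ x <;> simp [F, Set.indicator, h]
    have h2 : Set.Ioc 0 l ∩ Set.Ici t = Set.Icc t l := by
      ext x; simp only [Set.mem_inter_iff, Set.mem_Ioc, Set.mem_Ici, Set.mem_Icc]
      exact ⟨fun h => ⟨h.2, h.1.2⟩, fun h => ⟨⟨ht.1.trans_le h.1, h.2⟩, h.1⟩⟩
    simp only [h1]
    rw [setIntegral_indicator measurableSet_Ici, h2, integral_mul_const,
      integral_Icc_eq_integral_Ioc, ← intervalIntegral.integral_of_le ht.2,
      integral_eq_sub_of_hasDerivWithinAt_Icc ha ha' ht.1.le ht.2 le_rfl]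

/-- Integration by parts for a continuously differentiable and an absolutely continuous function. -/
theorem integral_mul_eq_sub_of_primitive {l : ℝ} (hl : 0 ≤ l) {a a' K k : ℝ → ℂ}
    (ha : ∀ x ∈ Set.Icc 0 l, HasDerivWithinAt a (a' x) (Set.Icc 0 l) x)
    (ha' : ContinuousOn a' (Set.Icc 0 l)) (hk : IntervalIntegrable k volume 0 l)
    (hK : ∀ x ∈ Set.Icc 0 l, K x = K 0 + ∫ t in (0 : ℝ)..x, k t) :
    ∫ x in (0 : ℝ)..l, a x * k x = a l * K l - a 0 * K 0 - ∫ x in (0 : ℝ)..l, a' x * K x := by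
  have hac : ContinuousOn a (Set.uIcc 0 l) := by
    rw [Set.uIcc_of_le hl]; exact fun x hx => (ha x hx).continuousWithinAt
  have hac' : ContinuousOn a' (Set.uIcc 0 l) := by rwa [Set.uIcc_of_le hl]
  have hprim : ContinuousOn (fun x => ∫ t in (0 : ℝ)..x, k t) (Set.uIcc 0 l) :=
    intervalIntegral.continuousOn_primitive_interval' hk Set.left_mem_uIcc
  have h1 : ∫ x in (0 : ℝ)..l, a' x * K x
      = ∫ x in (0 : ℝ)..l, (a' x * K 0 + a' x * ∫ t in (0 : ℝ)..x, k t) := by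
    refine intervalIntegral.integral_congr fun x hx => ?_
    rw [Set.uIcc_of_le hl] at hx
    simp only [hK x hx]; ring
  have h2 : ∫ t in (0 : ℝ)..l, (a l - a t) * k t
      = a l * (∫ t in (0 : ℝ)..l, k t) - ∫ t in (0 : ℝ)..l, a t * k t := by
    simp only [sub_mul]
    rw [intervalIntegral.integral_sub (hk.const_mul _) (hk.continuousOn_mul hac),
      intervalIntegral.integral_const_mul]
  rw [h1, intervalIntegral.integral_add (f := fun x => a' x * K 0)
    (g := fun x => a' x * ∫ t in (0 : ℝ)..x, k t) (hac'.mul continuousOn_const).intervalIntegrable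
    (hac'.mul hprim).intervalIntegrable, intervalIntegral.integral_mul_const,
    integral_mul_primitive_eq hl ha ha' hk, h2,
    integral_eq_sub_of_hasDerivWithinAt_Icc ha ha' le_rfl hl le_rfl, hK l ⟨hl, le_rfl⟩]
  ring

/-- `f ∈ W^{2,2}([0, l])` with `-f'' = h`, as in `MetricGraph.IsW22` on a single edge. -/
structure IsW22On (l : ℝ) (f h : Lp ℂ 2 ((volume : Measure ℝ).restrict (Set.Icc 0 l)))
    (u u' : ℝ → ℂ) : Prop where
  ae_eq : f =ᵐ[volume.restrict (Set.Icc 0 l)] u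
  deriv_eq : ∀ x ∈ Set.Icc 0 l, HasDerivWithinAt u (u' x) (Set.Icc 0 l) x
  deriv_deriv_eq : ∀ x ∈ Set.Icc 0 l, u' x = u' 0 + ∫ t in (0 : ℝ)..x, -(h t)

theorem ae_of_ae_restrict {l : ℝ} {p : ℝ → Prop}
    (h : ∀ᵐ t ∂(volume : Measure ℝ).restrict (Set.Icc 0 l), p t) {x : ℝ}
    (hx : x ∈ Set.Icc 0 l) : ∀ᵐ t ∂(volume : Measure ℝ), t ∈ Set.uIoc 0 x → p t := by
  filter_upwards [(ae_restrict_iff' measurableSet_Icc).1 h] with t ht htx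
  rw [Set.uIoc_of_le hx.1] at htx
  exact ht ⟨htx.1.le, htx.2.trans hx.2⟩

namespace IsW22On

variable {l : ℝ} {f h g k : Lp ℂ 2 ((volume : Measure ℝ).restrict (Set.Icc 0 l))}
  {u u' v v' : ℝ → ℂ}

theorem add (hf : IsW22On l f h u u') (hg : IsW22On l g k v v') :
    IsW22On l (f + g) (h + k) (u + v) (u' + v') where
  ae_eq := (Lp.coeFn_add f g).trans (hf.ae_eq.add hg.ae_eq)
  deriv_eq x hx := (hf.deriv_eq x hx).add (hg.deriv_eq x hx)
  deriv_deriv_eq x hx := by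
    have h1 : ∫ t in (0 : ℝ)..x, -((h + k : Lp ℂ 2 _) t) = ∫ t in (0 : ℝ)..x, (-(h t) + -(k t)) := by
      apply intervalIntegral.integral_congr_ae
      filter_upwards [ae_of_ae_restrict (Lp.coeFn_add h k) hx] with t ht htx
      rw [ht htx]; simp [add_comm]
    rw [h1, intervalIntegral.integral_add (f := fun t => -(h t)) (g := fun t => -(k t))
      (intervalIntegrable_coe hx _).neg (intervalIntegrable_coe hx _).neg]
    simp only [Pi.add_apply, hf.deriv_deriv_eq x hx, hg.deriv_deriv_eq x hx]
    ring

theorem continuousOn (hf : IsW22On l f h u u') : ContinuousOn u (Set.Icc 0 l) :=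
  fun x hx => (hf.deriv_eq x hx).continuousWithinAt

theorem continuousOn_deriv (hl : 0 ≤ l) (hf : IsW22On l f h u u') :
    ContinuousOn u' (Set.Icc 0 l) := by
  have h1 : ContinuousOn (fun x => u' 0 + ∫ t in (0 : ℝ)..x, -(h t)) (Set.uIcc 0 l) :=
    continuousOn_const.add (intervalIntegral.continuousOn_primitive_interval'
      (intervalIntegrable_coe ⟨hl, le_rfl⟩ h).neg Set.left_mem_uIcc)
  rw [Set.uIcc_of_le hl] at h1
  exact h1.congr fun x hx => hf.deriv_deriv_eq x hx

end IsW22On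

theorem inner_eq_intervalIntegral {l : ℝ} (hl : 0 ≤ l)
    {f g : Lp ℂ 2 ((volume : Measure ℝ).restrict (Set.Icc 0 l))} {u v : ℝ → ℂ}
    (hf : f =ᵐ[volume.restrict (Set.Icc 0 l)] u) (hg : g =ᵐ[volume.restrict (Set.Icc 0 l)] v) :
    inner ℂ f g = ∫ t in (0 : ℝ)..l, conj (u t) * v t := by
  rw [L2.inner_def, intervalIntegral.integral_of_le hl, ← integral_Icc_eq_integral_Ioc]
  refine integral_congr_ae ?_
  filter_upwards [hf, hg] with t h1 h2
  rw [RCLike.inner_apply, h1, h2, mul_comm]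

variable {l : ℝ} {f h g k : Lp ℂ 2 ((volume : Measure ℝ).restrict (Set.Icc 0 l))}
  {u u' v v' : ℝ → ℂ}

/-- Integrating by parts only once leaves ∫ conj u' · v', which becomes its conjugate when the two
functions are exchanged and so cancels in `inner_sub_inner`. -/
theorem IsW22On.inner_right (hl : 0 ≤ l) (hf : IsW22On l f h u u') (hg : IsW22On l g k v v') :
    inner ℂ f k = conj (u 0) * v' 0 - conj (u l) * v' l
      + ∫ t in (0 : ℝ)..l, conj (u' t) * v' t := by
  have hk : IntervalIntegrable (fun t => -(k t)) volume 0 l :=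
    (intervalIntegrable_coe ⟨hl, le_rfl⟩ k).neg
  have := integral_mul_eq_sub_of_primitive (a := fun t => conj (u t)) (a' := fun t => conj (u' t))
    hl (fun x hx => (hf.deriv_eq x hx).star)
    (Complex.continuous_conj.comp_continuousOn (hf.continuousOn_deriv hl)) hk hg.deriv_deriv_eq
  rw [inner_eq_intervalIntegral hl hf.ae_eq (Filter.EventuallyEq.refl _ k)]
  simp only [mul_neg, intervalIntegral.integral_neg] at this
  linear_combination -this

theorem IsW22On.inner_sub_inner (hl : 0 ≤ l) (hf : IsW22On l f h u u')
    (hg : IsW22On l g k v v') :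
    inner ℂ h g - inner ℂ f k = (conj (u' 0) * v 0 - conj (u 0) * v' 0)
      + (conj (-u' l) * v l - conj (u l) * -v' l) := by
  rw [← inner_conj_symm, hg.inner_right hl hf, hf.inner_right hl hg]
  have : conj (∫ t in (0 : ℝ)..l, conj (v' t) * u' t) = ∫ t in (0 : ℝ)..l, conj (u' t) * v' t := by
    rw [intervalIntegral.integral_of_le hl, intervalIntegral.integral_of_le hl, ← integral_conj]
    simp [mul_comm]
  simp only [map_add, map_sub, map_mul, Complex.conj_conj, this, map_neg]
  ring

end Interval

/-! ### Prescribed boundary data and weak solutions on an interval -/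

theorem memLp_of_continuous (l : ℝ) {u : ℝ → ℂ} (hu : Continuous u) :
    MemLp u 2 ((volume : Measure ℝ).restrict (Set.Icc 0 l)) := by
  obtain ⟨C, hC⟩ := (isCompact_Icc (a := (0 : ℝ)) (b := l)).exists_bound_of_continuousOn
    hu.continuousOn
  exact MemLp.of_bound hu.aestronglyMeasurable C
    ((ae_restrict_iff' measurableSet_Icc).2 (Filter.Eventually.of_forall hC))

theorem exists_isW22On_of_hasDerivAt (l : ℝ) {u u' u'' : ℝ → ℂ}
    (hu : ∀ x, HasDerivAt u (u' x) x) (hu' : ∀ x, HasDerivAt u' (u'' x) x)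
    (hu'' : Continuous u'') :
    ∃ f h, IsW22On l f h u u' ∧ h =ᵐ[volume.restrict (Set.Icc 0 l)] fun x => -u'' x := by
  have hc : Continuous u := continuous_iff_continuousAt.2 fun x => (hu x).continuousAt
  have hh := (memLp_of_continuous l hu''.neg).coeFn_toLp
  refine ⟨(memLp_of_continuous l hc).toLp u, (memLp_of_continuous l hu''.neg).toLp _,
    ⟨MemLp.coeFn_toLp _, fun x _ => (hu x).hasDerivWithinAt, fun x hx => ?_⟩, hh⟩
  have h1 : ∫ t in (0 : ℝ)..x, -((memLp_of_continuous l hu''.neg).toLp (-u'')) t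
      = ∫ t in (0 : ℝ)..x, u'' t := by
    apply intervalIntegral.integral_congr_ae
    filter_upwards [ae_of_ae_restrict hh hx] with t ht htx
    rw [ht htx]; simp
  have h2 := intervalIntegral.integral_eq_sub_of_hasDerivAt (a := 0) (b := x)
    (fun y _ => hu' y) (hu''.intervalIntegrable _ _)
  exact (by rw [h1, h2]; ring : u' x = u' 0 +
    ∫ t in (0 : ℝ)..x, -((memLp_of_continuous l hu''.neg).toLp (-u'')) t)

theorem exists_isW22On_boundary {l : ℝ} (hl : 0 < l) (a b c d : ℂ) :
    ∃ f h u u', IsW22On l f h u u' ∧ u 0 = a ∧ u l = b ∧ u' 0 = c ∧ u' l = d := by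
  have hl' : (l : ℂ) ≠ 0 := Complex.ofReal_ne_zero.2 hl.ne'
  -- Cubic Hermite interpolation: a + c x fits the data at 0, and p, q solve the two linear
  -- equations at l.
  let p : ℂ := (3 * (b - a) - (2 * c + d) * l) / l ^ 2
  let q : ℂ := (2 * (a - b) + (c + d) * l) / l ^ 3
  have hx : ∀ x : ℝ, HasDerivAt (fun x : ℝ => (x : ℂ)) 1 x := fun x =>
    Complex.ofRealCLM.hasDerivAt
  obtain ⟨f, h, hf, -⟩ := exists_isW22On_of_hasDerivAt l
    (u := fun x => a + c * x + p * x ^ 2 + q * x ^ 3)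
    (u' := fun x => c + 2 * p * x + 3 * q * x ^ 2)
    (u'' := fun x => 2 * p + 6 * q * x) (fun x => by
      have := ((((hx x).const_mul c).const_add a).add (((hx x).pow 2).const_mul p)).add
        (((hx x).pow 3).const_mul q)
      exact this.congr_deriv (by simp; ring)) (fun x => by
      have := (((hx x).const_mul (2 * p)).const_add c).add (((hx x).pow 2).const_mul (3 * q))
      exact this.congr_deriv (by simp; ring)) (by fun_prop)
  refine ⟨f, h, _, _, hf, by simp, ?_, by simp, ?_⟩
  · simp only [p, q]; field_simp; ring
  · simp only [p, q]; field_simp; ring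

theorem exists_isW22On_of_Lp {l : ℝ}
    (h : Lp ℂ 2 ((volume : Measure ℝ).restrict (Set.Icc 0 l))) :
    ∃ f u u', IsW22On l f h u u' ∧ u 0 = 0 ∧ u' 0 = 0 := by
  -- Cutting off outside the interval makes the integrand integrable on ℝ, so that both primitives
  -- are defined everywhere.
  have hi : Integrable ((Set.Icc 0 l).indicator fun t => -(h t)) volume :=
    ((integrable_indicator_iff measurableSet_Icc).2
      ((Lp.memLp h).integrable (by norm_num) : IntegrableOn h (Set.Icc 0 l) volume).neg)
  let u' : ℝ → ℂ := fun x => ∫ t in (0 : ℝ)..x, (Set.Icc 0 l).indicator (fun t => -(h t)) t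
  have hu' : Continuous u' := intervalIntegral.continuous_primitive (fun a b => hi.intervalIntegrable) 0
  let u : ℝ → ℂ := fun x => ∫ t in (0 : ℝ)..x, u' t
  have hu : ∀ x, HasDerivAt u (u' x) x := fun x => (hu'.integral_hasStrictDerivAt 0 x).hasDerivAt
  have hc : Continuous u := continuous_iff_continuousAt.2 fun x => (hu x).continuousAt
  refine ⟨(memLp_of_continuous l hc).toLp u, u, u',
    ⟨MemLp.coeFn_toLp _, fun x _ => (hu x).hasDerivWithinAt, fun x hx => ?_⟩, by simp [u],
    by simp [u']⟩
  have h0 : u' 0 = 0 := by simp [u']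
  rw [h0, zero_add]
  refine intervalIntegral.integral_congr fun t ht => ?_
  rw [Set.uIcc_of_le hx.1] at ht
  exact Set.indicator_of_mem (Set.Icc_subset_Icc_right hx.2 ht) _

/-- Functions orthogonal to all second derivatives of functions with vanishing boundary data are
affine. -/
theorem isW22On_zero_of_forall_inner_eq_zero {l : ℝ} (hl : 0 ≤ l)
    {g : Lp ℂ 2 ((volume : Measure ℝ).restrict (Set.Icc 0 l))}
    (hg : ∀ f h u u', IsW22On l f h u u' → u 0 = 0 → u l = 0 → u' 0 = 0 → u' l = 0 →
      inner ℂ h g = 0) : ∃ v v', IsW22On l g 0 v v' := by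
  have hx : ∀ x : ℝ, HasDerivAt (fun x : ℝ => (x : ℂ)) 1 x := fun x =>
    Complex.ofRealCLM.hasDerivAt
  have affine : ∀ α β : ℂ, ∃ f, IsW22On l f 0 (fun x : ℝ => α + β * x) (fun _ => β) := fun α β => by
    obtain ⟨f, h, hf, hh⟩ := exists_isW22On_of_hasDerivAt l (u := fun x : ℝ => α + β * x)
      (u' := fun _ => β) (u'' := fun _ => 0)
      (fun x => by simpa using ((hx x).const_mul β).const_add α)
      (fun x => hasDerivAt_const x β) continuous_const
    have : h = 0 := (Lp.eq_zero_iff_ae_eq_zero).2 (hh.trans (by simp; rfl))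
    exact ⟨f, this ▸ hf⟩
  obtain ⟨e₀, he₀⟩ := affine 1 0
  obtain ⟨e₁, he₁⟩ := affine 0 1
  -- The affine functions form a finite-dimensional, hence closed, space, so it suffices that g is
  -- orthogonal to Kᗮ. For h in Kᗮ, solve -u'' = h with zero data at 0; Green's identity against 1
  -- and x then gives u'(l) = 0 and u(l) = 0, so h is an admissible test.
  let K : Submodule ℂ (Lp ℂ 2 ((volume : Measure ℝ).restrict (Set.Icc 0 l))) :=
    Submodule.span ℂ {e₀, e₁}
  have : FiniteDimensional ℂ K := FiniteDimensional.span_of_finite ℂ (by simp)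
  have hgK : g ∈ K := by
    rw [← K.orthogonal_orthogonal, Submodule.mem_orthogonal]
    intro h hh
    obtain ⟨f, u, u', hf, hu0, hu'0⟩ := exists_isW22On_of_Lp h
    have h0 : inner ℂ h e₀ = 0 :=
      Submodule.inner_left_of_mem_orthogonal (Submodule.subset_span (by simp)) hh
    have h1 : inner ℂ h e₁ = 0 :=
      Submodule.inner_left_of_mem_orthogonal (Submodule.subset_span (by simp)) hh
    have g0 := hf.inner_sub_inner hl he₀
    have g1 := hf.inner_sub_inner hl he₁
    simp only [h0, h1, inner_zero_right, hu0, hu'0] at g0 g1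
    have hul' : u' l = 0 := by simpa using g0.symm
    have hul : u l = 0 := by simpa [hul'] using g1.symm
    exact hg f h u u' hf hu0 hul hu'0 hul'
  obtain ⟨α, β, hαβ⟩ := Submodule.mem_span_pair.1 hgK
  obtain ⟨e, he⟩ := affine α β
  have : g = e := by
    rw [← hαβ]
    refine Lp.ext ?_
    filter_upwards [Lp.coeFn_add (α • e₀) (β • e₁), Lp.coeFn_smul α e₀, Lp.coeFn_smul β e₁,
      he₀.ae_eq, he₁.ae_eq, he.ae_eq] with x h1 h2 h3 h4 h5 h6
    rw [h1, h6, Pi.add_apply, h2, h3]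
    simp [h4, h5]
  exact ⟨_, _, this ▸ he⟩

/-- The adjoint of `-f''` on functions with vanishing boundary data acts on `W^{2,2}`. -/
theorem exists_isW22On_of_forall_inner_eq {l : ℝ} (hl : 0 ≤ l)
    {g k : Lp ℂ 2 ((volume : Measure ℝ).restrict (Set.Icc 0 l))}
    (hgk : ∀ f h u u', IsW22On l f h u u' → u 0 = 0 → u l = 0 → u' 0 = 0 → u' l = 0 →
      inner ℂ h g = inner ℂ f k) : ∃ v v', IsW22On l g k v v' := by
  -- Subtracting a particular solution w of -w'' = k reduces to the homogeneous case.
  obtain ⟨w, v, v', hw, -, -⟩ := exists_isW22On_of_Lp k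
  obtain ⟨a, a', ha⟩ := isW22On_zero_of_forall_inner_eq_zero hl (g := g - w)
    fun f h u u' hf h1 h2 h3 h4 => by
      have := hf.inner_sub_inner hl hw
      rw [inner_sub_right, hgk f h u u' hf h1 h2 h3 h4]
      simp only [h1, h2, h3, h4] at this
      simp at this
      rw [← neg_sub, this, neg_zero]
  have := ha.add hw
  rw [sub_add_cancel, zero_add] at this
  exact ⟨_, _, this⟩

end QuantumGraph

/-! ### Green's identity and self-adjointness on a graph -/

theorem MetricGraph.sum_inc_eq_sum_ite {V E : Type*} [Fintype E] (Γ : MetricGraph V E) (v : V)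
    [DecidablePred fun e => Γ.src e = v ∨ Γ.tgt e = v] (F : E → ℂ) :
    ∑ e : Γ.Inc v, F e.1 = ∑ e : E, if Γ.src e = v ∨ Γ.tgt e = v then F e else 0 := by
  rw [← Finset.sum_filter]
  exact (Finset.sum_subtype _ (p := fun e => Γ.src e = v ∨ Γ.tgt e = v) (by simp) F).symm

open Classical in
theorem MetricGraph.sum_sum_inc {V E : Type*} [Fintype V] [Fintype E] (Γ : MetricGraph V E)
    (F : V → E → ℂ) :
    ∑ v, ∑ e : Γ.Inc v, F v e.1 = ∑ e, (F (Γ.src e) e + F (Γ.tgt e) e) := by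
  simp only [fun v => Γ.sum_inc_eq_sum_ite v (F v)]
  rw [Finset.sum_comm]
  refine Finset.sum_congr rfl fun e _ => ?_
  -- Without loops the two incidences exclude each other, so no end is lost in the disjunction.
  have h : ∀ v, (if Γ.src e = v ∨ Γ.tgt e = v then F v e else 0)
      = (if Γ.src e = v then F v e else 0) + if Γ.tgt e = v then F v e else 0 := fun v => by
    have := Γ.src_ne_tgt e
    by_cases h1 : Γ.src e = v
    · subst h1; simp [this.symm]
    · simp [h1]
  simp [h, Finset.sum_add_distrib]

namespace QuantumGraph

variable {V E : Type*} [Fintype E] (Γ : QuantumGraph V E)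

variable {Γ} in
theorem BC.congr {v : V} {x y x₁ y₁ : E → ℂ} (hx : ∀ e : Γ.Inc v, x e.1 = x₁ e.1)
    (hy : ∀ e : Γ.Inc v, y e.1 = y₁ e.1) (h : Γ.BC v x y) : Γ.BC v x₁ y₁ := by
  have e₁ : (fun e : Γ.Inc v => x e.1) = fun e : Γ.Inc v => x₁ e.1 := funext hx
  have e₂ : (fun e : Γ.Inc v => y e.1) = fun e : Γ.Inc v => y₁ e.1 := funext hy
  unfold BC at *
  rwa [e₁, e₂] at h

/-- The boundary form at the vertex `v`. -/
def boundaryForm (v : V) (x' y' x y : E → ℂ) : ℂ :=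
  ∑ e : Γ.Inc v, (conj (y' e.1) * x e.1 - conj (x' e.1) * y e.1)

/-- The condition at `v` describes a Lagrangian subspace for the boundary form. -/
def IsLagrangianAt (v : V) : Prop :=
  ∀ x y, Γ.BC v x y ↔ ∀ x' y', Γ.BC v x' y' → Γ.boundaryForm v x' y' x y = 0

variable {Γ} in
theorem boundaryForm_congr {v : V} {x' y' x y x₁' y₁' x₁ y₁ : E → ℂ}
    (hx' : ∀ e : Γ.Inc v, x' e.1 = x₁' e.1) (hy' : ∀ e : Γ.Inc v, y' e.1 = y₁' e.1)
    (hx : ∀ e : Γ.Inc v, x e.1 = x₁ e.1) (hy : ∀ e : Γ.Inc v, y e.1 = y₁ e.1) :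
    Γ.boundaryForm v x' y' x y = Γ.boundaryForm v x₁' y₁' x₁ y₁ :=
  Finset.sum_congr rfl fun e _ => by rw [hx', hy', hx, hy]

theorem isW22_iff {Γ : QuantumGraph V E} {f h : Γ.L2} {u u' : E → ℝ → ℂ} :
    Γ.IsW22 f h u u' ↔ ∀ e, IsW22On (Γ.len e) (f e) (h e) (u e) (u' e) :=
  ⟨fun H e => ⟨H.ae_eq e, H.deriv_eq e, H.deriv_deriv_eq e⟩,
    fun H => ⟨fun e => (H e).ae_eq, fun e => (H e).deriv_eq, fun e => (H e).deriv_deriv_eq⟩⟩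

theorem exists_isW22_of_vertexData (X Y : V → E → ℂ) :
    ∃ f h u u', Γ.IsW22 f h u u' ∧
      (∀ v, ∀ e : Γ.Inc v, Γ.vertexValue u v e.1 = X v e.1) ∧
      ∀ v, ∀ e : Γ.Inc v, Γ.outgoingDeriv u' v e.1 = Y v e.1 := by
  -- The sign at the target end is that of the outgoing derivative there.
  choose f h u u' H h0 hl h0' hl' using fun e => exists_isW22On_boundary (Γ.len_pos e)
    (X (Γ.src e) e) (X (Γ.tgt e) e) (Y (Γ.src e) e) (-Y (Γ.tgt e) e)
  refine ⟨WithLp.toLp 2 f, WithLp.toLp 2 h, u, u', isW22_iff.2 H, ?_, ?_⟩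
  · rintro v ⟨e, he⟩
    by_cases hs : Γ.src e = v
    · simp [MetricGraph.vertexValue, hs, h0]
    · simp [MetricGraph.vertexValue, hs, hl, he.resolve_left hs]
  · rintro v ⟨e, he⟩
    by_cases hs : Γ.src e = v
    · simp [MetricGraph.outgoingDeriv, hs, h0']
    · simp [MetricGraph.outgoingDeriv, hs, hl', he.resolve_left hs]

variable {Γ} in
/-- Green's identity. -/
theorem inner_sub_inner_eq_sum_boundaryForm [Fintype V] {f h g k : Γ.L2} {u u' w w' : E → ℝ → ℂ}
    (hf : Γ.IsW22 f h u u') (hg : Γ.IsW22 g k w w') :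
    inner ℂ h g - inner ℂ f k = ∑ v, Γ.boundaryForm v (Γ.vertexValue u v)
      (Γ.outgoingDeriv u' v) (Γ.vertexValue w v) (Γ.outgoingDeriv w' v) := by
  simp only [boundaryForm]
  rw [Γ.sum_sum_inc fun v e => conj (Γ.outgoingDeriv u' v e) * Γ.vertexValue w v e
    - conj (Γ.vertexValue u v e) * Γ.outgoingDeriv w' v e, PiLp.inner_apply, PiLp.inner_apply,
    ← Finset.sum_sub_distrib]
  refine Finset.sum_congr rfl fun e _ => ?_
  rw [(isW22_iff.1 hf e).inner_sub_inner (Γ.len_pos e).le (isW22_iff.1 hg e)]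
  simp [MetricGraph.vertexValue, MetricGraph.outgoingDeriv, Γ.src_ne_tgt e]

/-- Test functions on a single edge with zero boundary data satisfy every homogeneous condition,
which reduces the claim to the interval. -/
theorem exists_isW22_of_mem_adjoint {g k : Γ.L2} (hgk : (g, k) ∈ Γ.laplacianGraph.adjoint) :
    ∃ w w', Γ.IsW22 g k w w' := by
  classical
  suffices ∀ e, ∃ w w', IsW22On (Γ.len e) (g e) (k e) w w' by
    choose w w' hw using this
    exact ⟨w, w', isW22_iff.2 hw⟩
  intro e
  have hz : ∀ l, IsW22On l 0 0 0 0 := fun l =>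
    ⟨Lp.coeFn_zero _ _ _, fun x _ => hasDerivWithinAt_const _ _ _, fun x hx => by
      have h1 : ∫ t in (0 : ℝ)..x,
          -((0 : Lp ℂ 2 ((volume : Measure ℝ).restrict (Set.Icc 0 l))) t) = 0 := by
        apply intervalIntegral.integral_zero_ae
        filter_upwards [ae_of_ae_restrict (Lp.coeFn_zero ℂ 2 _) hx] with t ht htx
        rw [ht htx]; simp
      rw [h1]; simp⟩
  refine exists_isW22On_of_forall_inner_eq (Γ.len_pos e).le fun f h u u' hf h1 h2 h3 h4 => ?_
  have hmem : ((WithLp.toLp 2 (Pi.single e f) : Γ.L2), (WithLp.toLp 2 (Pi.single e h) : Γ.L2))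
      ∈ Γ.laplacianGraph := by
    refine ⟨Pi.single e u, Pi.single e u', isW22_iff.2 fun e' => ?_, fun v => ?_⟩
    · by_cases he : e' = e
      · subst he; simpa using hf
      · simpa [he] using hz _
    · refine (BC.zero v).congr (fun e' => ?_) fun e' => ?_
      · by_cases he : e'.1 = e
        · simp only [MetricGraph.vertexValue, he, Pi.single_eq_same, h1, h2, ite_self]
        · simp [MetricGraph.vertexValue, he]
      · by_cases he : e'.1 = e
        · simp only [MetricGraph.outgoingDeriv, he, Pi.single_eq_same, h3, h4, ite_self, neg_zero]
        · simp [MetricGraph.outgoingDeriv, he]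
  have := (Submodule.mem_adjoint_iff _ _).1 hgk _ _ hmem
  rw [PiLp.inner_apply, PiLp.inner_apply, Finset.sum_eq_single e, Finset.sum_eq_single e] at this
  · simpa [sub_eq_zero] using this
  · intro e' _ he; simp [he]
  · simp
  · intro e' _ he; simp [he]
  · simp

theorem eq_zero_of_isW22_zero {k : Γ.L2} {w w' : E → ℝ → ℂ} (h : Γ.IsW22 0 k w w') : k = 0 := by
  -- The same metric graph with no conditions at all: every W^{2,2} pair lies in its
  -- `laplacianGraph`.
  let Γ₀ : QuantumGraph V E :=
    { toMetricGraph := Γ.toMetricGraph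
      Row := fun _ => Empty
      rowFintype := fun _ => inferInstance
      A := fun _ => 0
      B := fun _ => 0 }
  exact Γ₀.laplacianGraph_functional (0, k) ⟨w, w', h, fun v => Subsingleton.elim _ _⟩ rfl

/-- If k is orthogonal to the domain, then (0, k) lies in the adjoint relation, so k = -0'' = 0. -/
theorem dense_laplacian_domain : Dense (Γ.laplacian.domain : Set Γ.L2) := by
  rw [Submodule.dense_iff_topologicalClosure_eq_top, Submodule.topologicalClosure_eq_top_iff,
    Submodule.eq_bot_iff]
  intro k hk
  obtain ⟨w, w', hw⟩ := Γ.exists_isW22_of_mem_adjoint (g := 0) (k := k) <| by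
    rw [Submodule.mem_adjoint_iff]
    intro a b hab
    rw [← laplacian_graph] at hab
    rw [inner_zero_right, zero_sub, neg_eq_zero]
    exact Submodule.inner_right_of_mem_orthogonal (LinearPMap.mem_domain_of_mem_graph hab) hk
  exact Γ.eq_zero_of_isW22_zero hw

theorem IsW22On.eqOn {l : ℝ} (hl : 0 < l)
    {f h k : Lp ℂ 2 ((volume : Measure ℝ).restrict (Set.Icc 0 l))} {u u' w w' : ℝ → ℂ}
    (hu : IsW22On l f h u u') (hw : IsW22On l f k w w') :
    Set.EqOn u w (Set.Icc 0 l) ∧ Set.EqOn u' w' (Set.Icc 0 l) := by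
  have h0 : Set.EqOn u w (Set.Icc 0 l) :=
    Measure.eqOn_Icc_of_ae_eq volume hl.ne (hu.ae_eq.symm.trans hw.ae_eq) hu.continuousOn
      hw.continuousOn
  exact ⟨h0, fun x hx => (uniqueDiffOn_Icc hl x hx).eq_deriv _ (hu.deriv_eq x hx)
    ((hw.deriv_eq x hx).congr h0 (h0 hx))⟩

theorem isSelfAdjoint_laplacian_iff_adjoint :
    IsSelfAdjoint Γ.laplacian ↔ Γ.laplacianGraph.adjoint = Γ.laplacianGraph := by
  rw [LinearPMap.isSelfAdjoint_def, ← Γ.laplacian_graph,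
    ← LinearPMap.adjoint_graph_eq_graph_adjoint Γ.dense_laplacian_domain]
  exact ⟨fun h => by rw [h], fun h => LinearPMap.eq_of_eq_graph h⟩

/-- The Laplacian is self-adjoint if and only if the conditions at all vertices are Lagrangian. -/
theorem isSelfAdjoint_laplacian_iff [Fintype V] :
    IsSelfAdjoint Γ.laplacian ↔ ∀ v, Γ.IsLagrangianAt v := by
  classical
  rw [isSelfAdjoint_laplacian_iff_adjoint]
  -- Data concentrated at one vertex leave a single term in Green's identity, which decouples the
  -- vertices.
  have realize : ∀ (v : V) (x y : E → ℂ), ∃ f h u u', Γ.IsW22 f h u u' ∧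
      (∀ e : Γ.Inc v, Γ.vertexValue u v e.1 = x e.1) ∧
      (∀ e : Γ.Inc v, Γ.outgoingDeriv u' v e.1 = y e.1) ∧
      ∀ w, w ≠ v → (∀ e : Γ.Inc w, Γ.vertexValue u w e.1 = 0) ∧
        ∀ e : Γ.Inc w, Γ.outgoingDeriv u' w e.1 = 0 := by
    intro v x y
    obtain ⟨f, h, u, u', hu, h1, h2⟩ := Γ.exists_isW22_of_vertexData
      (Function.update 0 v x) (Function.update 0 v y)
    exact ⟨f, h, u, u', hu, fun e => by rw [h1]; simp, fun e => by rw [h2]; simp,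
      fun w hw => ⟨fun e => by rw [h1]; simp [hw], fun e => by rw [h2]; simp [hw]⟩⟩
  have mem : ∀ (v : V) (x y : E → ℂ), Γ.BC v x y → ∀ f h u u', Γ.IsW22 f h u u' →
      (∀ e : Γ.Inc v, Γ.vertexValue u v e.1 = x e.1) →
      (∀ e : Γ.Inc v, Γ.outgoingDeriv u' v e.1 = y e.1) →
      (∀ w, w ≠ v → (∀ e : Γ.Inc w, Γ.vertexValue u w e.1 = 0) ∧
        ∀ e : Γ.Inc w, Γ.outgoingDeriv u' w e.1 = 0) → (f, h) ∈ Γ.laplacianGraph := by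
    intro v x y hxy f h u u' hu h1 h2 h3
    refine ⟨u, u', hu, fun w => ?_⟩
    by_cases hw : w = v
    · subst hw
      exact hxy.congr (fun e => (h1 e).symm) fun e => (h2 e).symm
    · exact (BC.zero w).congr (fun e => ((h3 w hw).1 e).symm) fun e => ((h3 w hw).2 e).symm
  constructor
  · intro H v x y
    obtain ⟨g, k, w, w', hw, hx, hy, h0⟩ := realize v x y
    have key : ∀ f h u u', Γ.IsW22 f h u u' → inner ℂ h g - inner ℂ f k
        = Γ.boundaryForm v (Γ.vertexValue u v) (Γ.outgoingDeriv u' v) x y := by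
      intro f h u u' hu
      rw [inner_sub_inner_eq_sum_boundaryForm hu hw, Finset.sum_eq_single v]
      · exact boundaryForm_congr (fun _ => rfl) (fun _ => rfl) hx hy
      · intro z _ hz
        refine Finset.sum_eq_zero fun e _ => ?_
        rw [(h0 z hz).1, (h0 z hz).2]; simp
      · simp
    constructor
    · intro hxy x' y' hxy'
      obtain ⟨f, h, u, u', hu, hx', hy', h0'⟩ := realize v x' y'
      have hm := mem v x y hxy g k w w' hw hx hy h0
      rw [← H, Submodule.mem_adjoint_iff] at hm
      have := hm f h (mem v x' y' hxy' f h u u' hu hx' hy' h0')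
      rw [key f h u u' hu] at this
      rw [← this]
      exact boundaryForm_congr (fun e => (hx' e).symm) (fun e => (hy' e).symm) (fun _ => rfl)
        fun _ => rfl
    · intro hxy
      have hm : (g, k) ∈ Γ.laplacianGraph.adjoint := by
        rw [Submodule.mem_adjoint_iff]
        rintro f h ⟨u, u', hu, hb⟩
        rw [key f h u u' hu]
        exact hxy _ _ (hb v)
      rw [H] at hm
      obtain ⟨z, z', hz, hb⟩ := hm
      -- Two W^{2,2} representatives of g agree up to the ends of the edges, so the condition known
      -- for z passes to the prescribed data x, y.
      have heq := fun e => (isW22_iff.1 hz e).eqOn (Γ.len_pos e) (isW22_iff.1 hw e)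
      have hl : ∀ e, 0 ∈ Set.Icc 0 (Γ.len e) := fun e => ⟨le_rfl, (Γ.len_pos e).le⟩
      have hr : ∀ e, Γ.len e ∈ Set.Icc 0 (Γ.len e) := fun e => ⟨(Γ.len_pos e).le, le_rfl⟩
      refine (hb v).congr (fun e => ?_) fun e => ?_
      · rw [← hx]
        simp only [MetricGraph.vertexValue, (heq e.1).1 (hl _), (heq e.1).1 (hr _)]
      · rw [← hy]
        simp only [MetricGraph.outgoingDeriv, (heq e.1).2 (hl _), (heq e.1).2 (hr _)]
  · intro H
    ext ⟨g, k⟩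
    constructor
    · intro hgk
      obtain ⟨w, w', hw⟩ := Γ.exists_isW22_of_mem_adjoint hgk
      refine ⟨w, w', hw, fun v => (H v _ _).2 fun x' y' hxy' => ?_⟩
      obtain ⟨f, h, u, u', hu, hx', hy', h0'⟩ := realize v x' y'
      have := (Submodule.mem_adjoint_iff _ _).1 hgk f h (mem v x' y' hxy' f h u u' hu hx' hy' h0')
      rw [inner_sub_inner_eq_sum_boundaryForm hu hw, Finset.sum_eq_single v] at this
      · rw [← this]
        exact boundaryForm_congr (fun e => (hx' e).symm) (fun e => (hy' e).symm) (fun _ => rfl)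
          fun _ => rfl
      · intro z _ hz
        refine Finset.sum_eq_zero fun e _ => ?_
        rw [(h0' z hz).1, (h0' z hz).2]; simp
      · simp
    · rintro ⟨w, w', hw, hb⟩
      rw [Submodule.mem_adjoint_iff]
      rintro f h ⟨u, u', hu, hb'⟩
      rw [inner_sub_inner_eq_sum_boundaryForm hu hw]
      exact Finset.sum_eq_zero fun v _ => (H v _ _).1 (hb v) _ _ (hb' v)

end QuantumGraph

/-! ### Averages over subgroups and invariant functionals -/

section InvariantFunctionals

variable {G W : Type*} [Group G] [Finite G] [AddCommGroup W] [Module ℂ W]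
  (ρ : Representation ℂ G W) (H : Subgroup G)

instance fintypeSubgroup : Fintype H := Fintype.ofFinite H

/-- The projection onto the invariants of a subgroup. -/
def subgroupAverage : W →ₗ[ℂ] W := (Nat.card H : ℂ)⁻¹ • ∑ h : H, ρ h

/-- A functional that is invariant under a subgroup. -/
def IsInvariantFunctional (ψ : Module.Dual ℂ W) : Prop :=
  ∀ h ∈ H, ∀ w, ψ (ρ h w) = ψ w

theorem subgroupAverage_apply (w : W) :
    subgroupAverage ρ H w = (Nat.card H : ℂ)⁻¹ • ∑ h : H, ρ h w := by
  simp [subgroupAverage]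

theorem card_subgroup_ne_zero : (Nat.card H : ℂ) ≠ 0 := Nat.cast_ne_zero.2 Nat.card_pos.ne'

theorem subgroupAverage_rho {g : G} (hg : g ∈ H) (w : W) :
    subgroupAverage ρ H (ρ g w) = subgroupAverage ρ H w := by
  rw [subgroupAverage_apply, subgroupAverage_apply]
  congr 1
  refine Fintype.sum_equiv (Equiv.mulRight (⟨g, hg⟩ : H)) _ _ fun h => ?_
  simp

theorem rho_subgroupAverage {g : G} (hg : g ∈ H) (w : W) :
    ρ g (subgroupAverage ρ H w) = subgroupAverage ρ H w := by
  rw [subgroupAverage_apply, map_smul, map_sum]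
  congr 1
  refine Fintype.sum_equiv (Equiv.mulLeft (⟨g, hg⟩ : H)) _ _ fun h => ?_
  simp

theorem subgroupAverage_mem (w : W) : subgroupAverage ρ H w ∈ (resRep ρ H).invariants :=
  fun g => rho_subgroupAverage ρ H g.2 w

theorem subgroupAverage_of_mem {w : W} (hw : w ∈ (resRep ρ H).invariants) :
    subgroupAverage ρ H w = w := by
  have h1 : ∀ h : H, ρ h w = w := fun h => hw h
  rw [subgroupAverage_apply]
  simp only [h1, Finset.sum_const, Finset.card_univ, ← Nat.card_eq_fintype_card,
    ← Nat.cast_smul_eq_nsmul ℂ]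
  rw [smul_smul, inv_mul_cancel₀ (card_subgroup_ne_zero H), one_smul]

theorem subgroupAverage_isProj :
    LinearMap.IsProj (resRep ρ H).invariants (subgroupAverage ρ H) :=
  ⟨subgroupAverage_mem ρ H, fun _ => subgroupAverage_of_mem ρ H⟩

variable {ρ H} in
theorem IsInvariantFunctional.apply_subgroupAverage {ψ : Module.Dual ℂ W}
    (hψ : IsInvariantFunctional ρ H ψ) (w : W) : ψ (subgroupAverage ρ H w) = ψ w := by
  have h1 : ∀ h : H, ψ (ρ h w) = ψ w := fun h => hψ h h.2 w
  rw [subgroupAverage_apply, map_smul, map_sum]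
  simp only [h1, Finset.sum_const, Finset.card_univ, ← Nat.card_eq_fintype_card, nsmul_eq_mul,
    smul_eq_mul]
  rw [← mul_assoc, inv_mul_cancel₀ (card_subgroup_ne_zero H), one_mul]

theorem isInvariantFunctional_comp_subgroupAverage (ψ : Module.Dual ℂ W) :
    IsInvariantFunctional ρ H (ψ ∘ₗ subgroupAverage ρ H) := fun h hh w => by
  simp [subgroupAverage_rho ρ H hh]

theorem subgroupAverage_eq_zero_of_mem_nontrivialPart {w : W}
    (hw : w ∈ nontrivialPart (resRep ρ H)) : subgroupAverage ρ H w = 0 := by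
  suffices nontrivialPart (resRep ρ H) ≤ LinearMap.ker (subgroupAverage ρ H) from this hw
  refine iSup_le fun U => iSup_le fun hU => iSup_le fun hU' w hw => ?_
  have hmem : subgroupAverage ρ H w ∈ U.toSubmodule := by
    rw [subgroupAverage_apply]
    exact U.toSubmodule.smul_mem _ (U.toSubmodule.sum_mem fun h _ => U.apply_mem_toSubmodule h hw)
  -- The average of w is an invariant vector of U. By irreducibility the invariants of U are 0 or U,
  -- and U is excluded by nontriviality.
  let I : Subrepresentation U.toRepresentation :=
    ⟨U.toRepresentation.invariants, fun g v hv => by rw [hv g]; exact hv⟩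
  rcases eq_bot_or_eq_top I with h | h
  · have h1 : (⟨_, hmem⟩ : U.toSubmodule) ∈ I.toSubmodule := fun g =>
      Subtype.ext (rho_subgroupAverage ρ H g.2 w)
    rw [h] at h1
    exact congrArg Subtype.val ((Submodule.mem_bot ℂ).1 h1)
  · refine absurd ⟨fun g => LinearMap.ext fun v => ?_⟩ hU'
    have h1 : v ∈ I.toSubmodule := by rw [h]; exact Submodule.mem_top
    exact h1 g

theorem trace_subgroupAverage [FiniteDimensional ℂ W] :
    LinearMap.trace ℂ W (subgroupAverage ρ H) = charInner H ρ.character fun _ => 1 := by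
  simp [subgroupAverage, charInner, Representation.character, finsum_eq_sum_of_fintype]

/-- The character sum is the trace of the averaging projection, that is, the dimension of the
invariants. A nonzero invariant vector is detected by some functional, whose average is then
invariant and nonzero. -/
theorem charInner_one_eq_zero_iff [FiniteDimensional ℂ W] :
    charInner H ρ.character (fun _ => 1) = 0 ↔
      ∀ ψ : Module.Dual ℂ W, IsInvariantFunctional ρ H ψ → ψ = 0 := by
  rw [← trace_subgroupAverage, (subgroupAverage_isProj ρ H).trace, Nat.cast_eq_zero,
    Submodule.finrank_eq_zero, Submodule.eq_bot_iff]
  constructor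
  · intro h ψ hψ
    ext w
    rw [← hψ.apply_subgroupAverage, h _ (subgroupAverage_mem ρ H w), map_zero]; rfl
  · intro h w hw
    refine (Module.forall_dual_apply_eq_zero_iff ℂ w).1 fun ψ => ?_
    have := LinearMap.congr_fun (h _ (isInvariantFunctional_comp_subgroupAverage ρ H ψ)) w
    simpa [subgroupAverage_of_mem ρ H hw] using this

/-- An invariant functional factors through the average, which fixes the first n basis vectors and
kills the others. This is why dᵢ copies of an edge carry all the data. -/
theorem isInvariantFunctional_iff_of_basis {d n : ℕ} (b : Module.Basis (Fin d) ℂ W)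
    (h1 : ∀ j : Fin d, (j : ℕ) < n → b j ∈ (resRep ρ H).invariants)
    (h2 : ∀ j : Fin d, n ≤ (j : ℕ) → b j ∈ nontrivialPart (resRep ρ H)) (ψ : Module.Dual ℂ W) :
    IsInvariantFunctional ρ H ψ ↔ ∀ j : Fin d, n ≤ (j : ℕ) → ψ (b j) = 0 := by
  constructor
  · intro h j hj
    rw [← h.apply_subgroupAverage, subgroupAverage_eq_zero_of_mem_nontrivialPart ρ H (h2 j hj),
      map_zero]
  · intro h
    have : ψ = ψ ∘ₗ subgroupAverage ρ H := b.ext fun j => by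
      rcases lt_or_ge (j : ℕ) n with hj | hj
      · simp [subgroupAverage_of_mem ρ H (h1 j hj)]
      · simp [h j hj, subgroupAverage_eq_zero_of_mem_nontrivialPart ρ H (h2 j hj)]
    rw [this]
    exact isInvariantFunctional_comp_subgroupAverage ρ H ψ

end InvariantFunctionals

/-! ### The action on the edges at a vertex -/

namespace QuantumGraph

variable {V E : Type*} (Γ : QuantumGraph V E)

theorem exists_eq_restrict_inc {v : V} (x : Γ.Inc v → ℂ) :
    ∃ z : E → ℂ, (fun e : Γ.Inc v => z e.1) = x :=
  ⟨Function.extend Subtype.val x 0, funext fun e => Subtype.val_injective.extend_apply x 0 e⟩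

variable [Fintype E]

/-- The boundary condition at `v` for functions on the set of edges incident to `v`. -/
def BCInc (v : V) (x y : Γ.Inc v → ℂ) : Prop := Γ.A v *ᵥ x + Γ.B v *ᵥ y = 0

theorem isLagrangianAt_iff {v : V} : Γ.IsLagrangianAt v ↔ ∀ x y, Γ.BCInc v x y ↔
    ∀ x' y', Γ.BCInc v x' y' → ∑ e, (conj (y' e) * x e - conj (x' e) * y e) = 0 := by
  constructor
  · intro H x y
    obtain ⟨x, rfl⟩ := Γ.exists_eq_restrict_inc x
    obtain ⟨y, rfl⟩ := Γ.exists_eq_restrict_inc y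
    refine (H x y).trans ⟨fun h x' y' hxy' => ?_, fun h x' y' hxy' => h _ _ hxy'⟩
    obtain ⟨x', rfl⟩ := Γ.exists_eq_restrict_inc x'
    obtain ⟨y', rfl⟩ := Γ.exists_eq_restrict_inc y'
    exact h x' y' hxy'
  · intro H x y
    refine (H _ _).trans ⟨fun h x' y' hxy' => h _ _ hxy', fun h x' y' hxy' => ?_⟩
    obtain ⟨x', rfl⟩ := Γ.exists_eq_restrict_inc x'
    obtain ⟨y', rfl⟩ := Γ.exists_eq_restrict_inc y'
    exact h x' y' hxy'

namespace IsAction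

variable {Γ} {G : Type*} [Group G] [MulAction G V] [MulAction G E] (hG : Γ.IsAction G)
include hG

theorem src_or_tgt_smul {g : G} {e : E} {v : V} (h : Γ.src e = v ∨ Γ.tgt e = v) :
    Γ.src (g • e) = g • v ∨ Γ.tgt (g • e) = g • v := by
  have := Sym2.eq_iff.1 (hG.ends g e)
  rcases h with rfl | rfl <;> tauto

/-- One end of g • e is v. If it were the image of the other end of e rather than of v, then g would
carry that end to its neighbour v. -/
theorem smul_eq_of_smul_inc {v : V} {g : G} (e e' : Γ.Inc v) (h : g • e.1 = e'.1) :
    g • v = v := by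
  obtain ⟨e, he⟩ := e
  obtain ⟨e', he'⟩ := e'
  dsimp at h
  subst h
  have h1 := hG.src_or_tgt_smul (g := g) he
  have h2 := hG.smul_src_ne_tgt g e
  have h3 := hG.smul_src_ne_tgt g⁻¹ e
  have h4 := Sym2.eq_iff.1 (hG.ends g e)
  rw [Ne, inv_smul_eq_iff] at h3
  rcases he with rfl | rfl <;> rcases h4 with ⟨h4, h5⟩ | ⟨h4, h5⟩ <;> rw [h4, h5] at he' <;>
    rcases he' with h6 | h6 <;> first | exact h6 | exact absurd h6 h2 | exact absurd h6.symm h3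

theorem smul_inc {v : V} {g : G} (hg : g ∈ MulAction.stabilizer G v) (e : Γ.Inc v) :
    Γ.src (g • e.1) = v ∨ Γ.tgt (g • e.1) = v := by
  have := hG.src_or_tgt_smul (g := g) e.2
  rwa [MulAction.mem_stabilizer_iff.1 hg] at this

/-- Edges at `v` in the same orbit are in the same orbit under the stabilizer of `v`. -/
theorem card_inc_orbit_mul_card_stabilizer [Finite G] {v : V} (e : Γ.Inc v) :
    Nat.card {e' : Γ.Inc v // (Quotient.mk'' e'.1 : MulAction.orbitRel.Quotient G E)
      = Quotient.mk'' e.1} * Nat.card (MulAction.stabilizer G e.1)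
      = Nat.card (MulAction.stabilizer G v) := by
  have h1 : {e' : Γ.Inc v // (Quotient.mk'' e'.1 : MulAction.orbitRel.Quotient G E)
      = Quotient.mk'' e.1} ≃ MulAction.orbit (MulAction.stabilizer G v) e.1 :=
    { toFun := fun e' => ⟨e'.1.1, by
        obtain ⟨g, hg⟩ := Quotient.eq''.1 e'.2
        exact ⟨⟨g, hG.smul_eq_of_smul_inc e e'.1 hg⟩, hg⟩⟩
      invFun := fun e' => ⟨⟨e'.1, by
          obtain ⟨g, hg⟩ := e'.2
          rw [← hg]; exact hG.smul_inc g.2 e⟩, by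
          obtain ⟨g, hg⟩ := e'.2
          exact Quotient.sound' ⟨g.1, hg⟩⟩
      left_inv := fun _ => rfl
      right_inv := fun _ => rfl }
  -- An element fixing e cannot swap its ends, so it fixes v: the stabilizer of e in G is already
  -- the one in G_v.
  have h2 : MulAction.stabilizer G e.1 ≃ MulAction.stabilizer (MulAction.stabilizer G v) e.1 :=
    { toFun := fun g => ⟨⟨g.1, hG.smul_eq_of_smul_inc e e g.2⟩, g.2⟩
      invFun := fun g => ⟨g.1.1, g.2⟩
      left_inv := fun _ => rfl
      right_inv := fun _ => rfl }
  rw [Nat.card_congr h1, Nat.card_congr h2, ← Nat.card_prod]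
  exact Nat.card_congr (MulAction.orbitProdStabilizerEquivGroup _ _)

end IsAction

end QuantumGraph

/-! ### Boundary data of the quotient as equivariant families of functionals -/

namespace QuotientChoice

variable {V E G W : Type*} [Group G] [MulAction G V] [MulAction G E]
    [AddCommGroup W] [Module ℂ W] {Γ : QuantumGraph V E} {ρ : Representation ℂ G W} {d : ℕ}
    (Q : QuotientChoice Γ ρ d)

/-- The extension by zero of a function on the edges of the quotient to all pairs of an orbit of
edges and a basis vector. -/
def extendEdge (X : Q.Edge → ℂ) (i : MulAction.orbitRel.Quotient G E) (j : Fin d) : ℂ :=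
  if h : (j : ℕ) < Q.edgeDim i then X ⟨i, j, h⟩ else 0

theorem extendEdge_of_lt (X : Q.Edge → ℂ) {i : MulAction.orbitRel.Quotient G E} {j : Fin d}
    (h : (j : ℕ) < Q.edgeDim i) : Q.extendEdge X i j = X ⟨i, j, h⟩ := dif_pos h

theorem extendEdge_of_le (X : Q.Edge → ℂ) {i : MulAction.orbitRel.Quotient G E} {j : Fin d}
    (h : Q.edgeDim i ≤ (j : ℕ)) : Q.extendEdge X i j = 0 := dif_neg (not_lt.2 h)

/-- The functional on the representation space which is given by the values on the copies of an edge
representative. -/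
def edgeFunctional (X : Q.Edge → ℂ) (i : MulAction.orbitRel.Quotient G E) : Module.Dual ℂ W :=
  ∑ j, Q.extendEdge X i j • (Q.bE i).coord j

/-- The functionals on the edges at the representative of a vertex orbit which are given by values
on the edges of the quotient. -/
def lift (k : MulAction.orbitRel.Quotient G V) (X : Q.Edge → ℂ) (e : Γ.Inc (Q.vertRep k)) :
    Module.Dual ℂ W :=
  Q.edgeFunctional X (Quotient.mk'' e.1) ∘ₗ ρ (Q.trans k e)⁻¹

/-- Equivariance of a family of functionals on the edges at a vertex. -/
def _root_.QuantumGraph.IsEquivariant (ρ : Representation ℂ G W) {v : V}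
    (ψ : Γ.Inc v → Module.Dual ℂ W) : Prop :=
  ∀ (g : G) (e e' : Γ.Inc v), g • e.1 = e'.1 → ∀ w, ψ e' (ρ g w) = ψ e w

theorem edgeFunctional_bE (X : Q.Edge → ℂ) (i : MulAction.orbitRel.Quotient G E) (j : Fin d) :
    Q.edgeFunctional X i (Q.bE i j) = Q.extendEdge X i j := by
  simp [edgeFunctional, Finsupp.single_apply]

theorem isInvariantFunctional_edgeFunctional [Finite G] (X : Q.Edge → ℂ)
    (i : MulAction.orbitRel.Quotient G E) :
    IsInvariantFunctional ρ (MulAction.stabilizer G (Q.edgeRep i)) (Q.edgeFunctional X i) :=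
  (isInvariantFunctional_iff_of_basis ρ _ (Q.bE i) (Q.bE_mem_invariants i)
    (Q.bE_mem_nontrivialPart i) _).2 fun j hj => by
      rw [edgeFunctional_bE, Q.extendEdge_of_le X hj]

theorem isEquivariant_lift [Finite G] (k : MulAction.orbitRel.Quotient G V) (X : Q.Edge → ℂ) :
    Γ.IsEquivariant ρ (Q.lift k X) := by
  intro g e e' h w
  have hν : (Quotient.mk'' e'.1 : MulAction.orbitRel.Quotient G E) = Quotient.mk'' e.1 :=
    Quotient.sound' ⟨g, h⟩
  -- The two ways from the representative edge to e', directly or through e, differ by an element of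
  -- its stabilizer, which the invariant `edgeFunctional` absorbs.
  have hs : (Q.trans k e')⁻¹ * g * Q.trans k e
      ∈ MulAction.stabilizer G (Q.edgeRep (Quotient.mk'' e.1)) := by
    rw [MulAction.mem_stabilizer_iff, mul_smul, mul_smul, Q.trans_spec, h, inv_smul_eq_iff, ← hν,
      Q.trans_spec]
  have := Q.isInvariantFunctional_edgeFunctional X _ _ hs (ρ (Q.trans k e)⁻¹ w)
  rw [← Module.End.mul_apply, ← map_mul, mul_inv_cancel_right, map_mul, Module.End.mul_apply]
    at this
  simp only [lift, LinearMap.comp_apply, hν, this]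

theorem exists_lift_eq [Finite G] {k : MulAction.orbitRel.Quotient G V}
    {ψ : Γ.Inc (Q.vertRep k) → Module.Dual ℂ W} (hψ : Γ.IsEquivariant ρ ψ) :
    ∃ X, Q.lift k X = ψ := by
  classical
  -- The coefficients are read off at an arbitrary edge of the orbit at ṽ_k; equivariance makes the
  -- choice irrelevant. Orbits not meeting ṽ_k play no role and get 0.
  let X : Q.Edge → ℂ := fun ε =>
    if h : ∃ e : Γ.Inc (Q.vertRep k), Quotient.mk'' e.1 = ε.1 then
      ψ h.choose (ρ (Q.trans k h.choose) (Q.bE ε.1 ε.2.1)) else 0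
  refine ⟨X, funext fun e => ?_⟩
  have key : Q.edgeFunctional X (Quotient.mk'' e.1) = ψ e ∘ₗ ρ (Q.trans k e) := by
    refine (Q.bE (Quotient.mk'' e.1)).ext fun j => ?_
    rw [edgeFunctional_bE]
    rcases lt_or_ge (j : ℕ) (Q.edgeDim (Quotient.mk'' e.1)) with hj | hj
    · rw [Q.extendEdge_of_lt X hj]
      have h : ∃ e' : Γ.Inc (Q.vertRep k),
          (Quotient.mk'' e'.1 : MulAction.orbitRel.Quotient G E) = Quotient.mk'' e.1 := ⟨e, rfl⟩
      have h1 : (Q.trans k e * (Q.trans k h.choose)⁻¹) • h.choose.1 = e.1 := by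
        conv_lhs => rw [← Q.trans_spec k h.choose]
        rw [mul_smul, inv_smul_smul, h.choose_spec, Q.trans_spec]
      have h2 := hψ _ _ _ h1 (ρ (Q.trans k h.choose) (Q.bE (Quotient.mk'' e.1) j))
      rw [← Module.End.mul_apply, ← map_mul, inv_mul_cancel_right] at h2
      simp only [X]
      rw [dif_pos h, ← h2]; rfl
    -- Pulled back to the representative edge, ψ e is invariant under its stabilizer and so vanishes
    -- on the basis vectors that have no copy in the quotient.
    · have hinv : IsInvariantFunctional ρ
          (MulAction.stabilizer G (Q.edgeRep (Quotient.mk'' e.1))) (ψ e ∘ₗ ρ (Q.trans k e)) := by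
        intro g hg w
        have h1 : (Q.trans k e * g * (Q.trans k e)⁻¹) • e.1 = e.1 := by
          conv_lhs => rw [← Q.trans_spec k e]
          rw [mul_smul, inv_smul_smul, mul_smul, MulAction.mem_stabilizer_iff.1 hg, Q.trans_spec]
        have h2 := hψ _ _ _ h1 (ρ (Q.trans k e) w)
        rw [← Module.End.mul_apply, ← map_mul, inv_mul_cancel_right, map_mul,
          Module.End.mul_apply] at h2
        exact h2
      rw [Q.extendEdge_of_le X hj]
      exact ((isInvariantFunctional_iff_of_basis ρ _ (Q.bE _) (Q.bE_mem_invariants _)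
        (Q.bE_mem_nontrivialPart _) _).1 hinv j hj).symm
  ext w
  simp [lift, key]

theorem lift_apply_b (k : MulAction.orbitRel.Quotient G V) (X : Q.Edge → ℂ)
    (e : Γ.Inc (Q.vertRep k)) (a : Fin d) :
    Q.lift k X e (Q.b a) = (Q.extendEdge X (Quotient.mk'' e.1) ᵥ*
      LinearMap.toMatrix Q.b (Q.bE (Quotient.mk'' e.1)) (ρ (Q.trans k e)⁻¹)) a := by
  simp [lift, edgeFunctional, Matrix.vecMul, dotProduct, LinearMap.toMatrix_apply]

/-- The inner product of functionals for which the dual of the basis `b` is orthonormal. -/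
def dualInner (φ ψ : Module.Dual ℂ W) : ℂ := ∑ a, conj (φ (Q.b a)) * ψ (Q.b a)

/-- In coordinates the lift multiplies a row vector by [ρ(g⁻¹)], the inverse of the unitary matrix
[ρ(g)]; hence it preserves inner products. -/
theorem dualInner_lift (hU : ∀ (g : G) (i : MulAction.orbitRel.Quotient G E),
      LinearMap.toMatrix (Q.bE i) Q.b (ρ g) ∈ Matrix.unitaryGroup (Fin d) ℂ)
    (k : MulAction.orbitRel.Quotient G V) (X Y : Q.Edge → ℂ) (e : Γ.Inc (Q.vertRep k)) :
    Q.dualInner (Q.lift k X e) (Q.lift k Y e) = ∑ j, conj (Q.extendEdge X (Quotient.mk'' e.1) j)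
      * Q.extendEdge Y (Quotient.mk'' e.1) j := by
  set i : MulAction.orbitRel.Quotient G E := Quotient.mk'' e.1
  set M := LinearMap.toMatrix Q.b (Q.bE i) (ρ (Q.trans k e)⁻¹) with hM
  have hN := hU (Q.trans k e) i
  set N := LinearMap.toMatrix (Q.bE i) Q.b (ρ (Q.trans k e)) with hN'
  have hMN : M * N = 1 := by
    rw [hM, hN', ← LinearMap.toMatrix_comp, ← Module.End.mul_eq_comp, ← map_mul, inv_mul_cancel,
      map_one, Module.End.one_eq_id, LinearMap.toMatrix_id]
  have hMs : M = star N := by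
    rw [← mul_one M, ← (Matrix.mem_unitaryGroup_iff).1 hN, ← mul_assoc, hMN, one_mul]
  have hMM : M * Mᴴ = 1 := by
    rw [← Matrix.star_eq_conjTranspose, hMs, star_star, (Matrix.mem_unitaryGroup_iff').1 hN]
  have h1 : Q.dualInner (Q.lift k X e) (Q.lift k Y e)
      = (Q.extendEdge Y i ᵥ* M) ⬝ᵥ star (Q.extendEdge X i ᵥ* M) := by
    simp only [dualInner, lift_apply_b, dotProduct, Pi.star_apply]
    exact Finset.sum_congr rfl fun a _ => mul_comm _ _
  rw [h1, Matrix.star_vecMul, ← Matrix.dotProduct_mulVec, Matrix.mulVec_mulVec, hMM,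
    Matrix.one_mulVec]
  exact Finset.sum_congr rfl fun a _ => mul_comm _ _

variable [Fintype E] (hG : Γ.IsAction G)

theorem inc_metricQuotient_iff (k : MulAction.orbitRel.Quotient G V) (ε : Q.Edge) :
    ((Q.metricQuotient hG).src ε = k ∨ (Q.metricQuotient hG).tgt ε = k) ↔
      ∃ e : Γ.Inc (Q.vertRep k), Quotient.mk'' e.1 = ε.1 := by
  have key : ∀ v, (Quotient.mk'' v : MulAction.orbitRel.Quotient G V) = k ↔
      ∃ g : G, g • v = Q.vertRep k := fun v => by
    conv_lhs => rw [← Q.vertRep_spec k]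
    rw [eq_comm, Quotient.eq'']
    exact Iff.rfl
  simp only [metricQuotient, key]
  constructor
  · rintro (⟨g, hg⟩ | ⟨g, hg⟩)
    · refine ⟨⟨g • Q.edgeRep ε.1, ?_⟩, ?_⟩
      · rw [← hg]; exact hG.src_or_tgt_smul (Or.inl rfl)
      · conv_rhs => rw [← Q.edgeRep_spec ε.1]
        exact Quotient.sound' ⟨g, rfl⟩
    · refine ⟨⟨g • Q.edgeRep ε.1, ?_⟩, ?_⟩
      · rw [← hg]; exact hG.src_or_tgt_smul (Or.inr rfl)
      · conv_rhs => rw [← Q.edgeRep_spec ε.1]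
        exact Quotient.sound' ⟨g, rfl⟩
  · rintro ⟨e, he⟩
    have h1 := hG.src_or_tgt_smul (g := (Q.trans k e)⁻¹) e.2
    rw [← he]
    have h2 : (Q.trans k e)⁻¹ • e.1 = Q.edgeRep (Quotient.mk'' e.1) := by
      rw [inv_smul_eq_iff, Q.trans_spec]
    rw [h2] at h1
    rcases h1 with h1 | h1
    · exact Or.inl ⟨Q.trans k e, by rw [h1, smul_inv_smul]⟩
    · exact Or.inr ⟨Q.trans k e, by rw [h1, smul_inv_smul]⟩

theorem Theta_mulVec (k : MulAction.orbitRel.Quotient G V) (X : Q.Edge → ℂ)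
    (p : Γ.Inc (Q.vertRep k) × Fin d) :
    (Q.Theta hG k *ᵥ fun ε => X ε.1) p = Q.extendEdge X (Quotient.mk'' p.1.1) p.2 := by
  classical
  have h0 : (Q.Theta hG k *ᵥ fun ε => X ε.1) p = ∑ ε : (Q.metricQuotient hG).Inc k,
      if (Quotient.mk'' p.1.1 : MulAction.orbitRel.Quotient G E) = ε.1.1 ∧ p.2 = ε.1.2.1
        then X ε.1 else 0 := by
    simp only [Matrix.mulVec, dotProduct, Theta, Matrix.of_apply, ite_mul, one_mul, zero_mul]
  rw [h0]
  rcases lt_or_ge (p.2 : ℕ) (Q.edgeDim (Quotient.mk'' p.1.1)) with h | h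
  · let ε : Q.Edge := ⟨Quotient.mk'' p.1.1, p.2, h⟩
    have hε := (Q.inc_metricQuotient_iff hG k ε).2 ⟨p.1, rfl⟩
    let ε' : (Q.metricQuotient hG).Inc k := ⟨ε, hε⟩
    refine (Finset.sum_eq_single ε' ?_ ?_).trans ?_
    · rintro ⟨⟨i, j, hj⟩, h'⟩ _ hne
      refine if_neg ?_
      rintro ⟨h1, h2⟩
      dsimp at h1 h2
      subst h1 h2
      exact hne rfl
    · exact fun hn => absurd (Finset.mem_univ _) hn
    · rw [Q.extendEdge_of_lt X h]
      exact if_pos ⟨rfl, rfl⟩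
  · rw [Q.extendEdge_of_le X h]
    refine Finset.sum_eq_zero ?_
    rintro ⟨⟨i, j, hj⟩, h'⟩ _
    refine if_neg ?_
    rintro ⟨h1, h2⟩
    dsimp at h1 h2
    subst h1 h2
    exact absurd hj (not_lt.2 h)

theorem diagRep_mulVec (k : MulAction.orbitRel.Quotient G V)
    (z : Γ.Inc (Q.vertRep k) × Fin d → ℂ) (p : Γ.Inc (Q.vertRep k) × Fin d) :
    (Q.diagRep k *ᵥ z) p = ((fun j => z (p.1, j)) ᵥ*
      LinearMap.toMatrix Q.b (Q.bE (Quotient.mk'' p.1.1)) (ρ (Q.trans k p.1)⁻¹)) p.2 := by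
  simp only [Matrix.mulVec, Matrix.vecMul, dotProduct, diagRep, Matrix.transpose_apply,
    Matrix.submatrix_apply, Fintype.sum_prod_type, Prod.swap, Matrix.blockDiagonal_apply, ite_mul,
    zero_mul]
  rw [Finset.sum_eq_single p.1]
  · simp [mul_comm]
  · intro e _ he; simp [he]
  · simp

theorem kronecker_one_mulVec {R I J : Type*} [Fintype I] [Fintype J] [DecidableEq J]
    (A : Matrix R I ℂ) (z : I × J → ℂ) (p : R × J) :
    ((A ⊗ₖ (1 : Matrix J J ℂ)) *ᵥ z) p = (A *ᵥ fun i => z (i, p.2)) p.1 := by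
  simp [Matrix.mulVec, dotProduct, Fintype.sum_prod_type, Matrix.one_apply]

/-- Θ extends by zero, the blocks of D evaluate the lifted functionals on the basis `b`, and A ⊗ 1
acts on each basis index separately. -/
theorem bc_quotient_iff (k : MulAction.orbitRel.Quotient G V) (X Y : Q.Edge → ℂ) :
    (Q.quotient hG).BC k X Y ↔ ∀ a, Γ.BCInc (Q.vertRep k) (fun e => Q.lift k X e (Q.b a))
      (fun e => Q.lift k Y e (Q.b a)) := by
  have key : ∀ (A : Matrix (Γ.Row (Q.vertRep k)) (Γ.Inc (Q.vertRep k)) ℂ) (X : Q.Edge → ℂ) r a,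
      (((A ⊗ₖ (1 : Matrix (Fin d) (Fin d) ℂ)) * Q.diagRep k * Q.Theta hG k) *ᵥ fun ε => X ε.1)
        (r, a) = (A *ᵥ fun e => Q.lift k X e (Q.b a)) r := by
    intro A X r a
    rw [← Matrix.mulVec_mulVec, ← Matrix.mulVec_mulVec, kronecker_one_mulVec]
    simp only [diagRep_mulVec, Theta_mulVec, lift_apply_b]
  change ((Γ.A (Q.vertRep k) ⊗ₖ (1 : Matrix (Fin d) (Fin d) ℂ)) * Q.diagRep k * Q.Theta hG k) *ᵥ
      (fun ε : (Q.metricQuotient hG).Inc k => X ε.1)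
    + ((Γ.B (Q.vertRep k) ⊗ₖ (1 : Matrix (Fin d) (Fin d) ℂ)) * Q.diagRep k * Q.Theta hG k) *ᵥ
      (fun ε : (Q.metricQuotient hG).Inc k => Y ε.1) = 0 ↔ _
  simp only [funext_iff, QuantumGraph.BCInc, Pi.add_apply, Prod.forall, key, Pi.zero_apply]
  exact forall_comm

/-- The number of edges at the representative of a vertex orbit in a given orbit of edges. -/
def mult (k : MulAction.orbitRel.Quotient G V) (i : MulAction.orbitRel.Quotient G E) : ℕ :=
  Nat.card {e : Γ.Inc (Q.vertRep k) // Quotient.mk'' e.1 = i}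

theorem mult_ne_zero_iff (k : MulAction.orbitRel.Quotient G V)
    (i : MulAction.orbitRel.Quotient G E) :
    Q.mult k i ≠ 0 ↔ ∃ e : Γ.Inc (Q.vertRep k), Quotient.mk'' e.1 = i := by
  rw [mult, Ne, Finite.card_eq_zero_iff, not_isEmpty_iff, nonempty_subtype]

theorem sum_inc_orbit (k : MulAction.orbitRel.Quotient G V)
    [Fintype (MulAction.orbitRel.Quotient G E)] (S : MulAction.orbitRel.Quotient G E → ℂ) :
    ∑ e : Γ.Inc (Q.vertRep k), S (Quotient.mk'' e.1) = ∑ i, (Q.mult k i : ℂ) * S i := by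
  classical
  rw [← Finset.sum_fiberwise (s := Finset.univ)
    (g := fun e : Γ.Inc (Q.vertRep k) => (Quotient.mk'' e.1 : MulAction.orbitRel.Quotient G E))]
  refine Finset.sum_congr rfl fun i _ => ?_
  rw [Finset.sum_congr rfl (g := fun _ => S i) fun e he => by rw [(Finset.mem_filter.1 he).2],
    Finset.sum_const, nsmul_eq_mul, mult, Nat.card_eq_fintype_card, Fintype.card_subtype]

/-- Summing over the edges of Γ at ṽ_k counts each orbit `mult` times; the weight undoes this. -/
theorem sum_inc_quotient (k : MulAction.orbitRel.Quotient G V) (F : Q.Edge → ℂ) :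
    ∑ ε : (Q.quotient hG).Inc k, F ε.1 = ∑ e : Γ.Inc (Q.vertRep k),
      (Q.mult k (Quotient.mk'' e.1) : ℂ)⁻¹ * ∑ j, Q.extendEdge F (Quotient.mk'' e.1) j := by
  classical
  have : Finite (MulAction.orbitRel.Quotient G E) := Quotient.finite _
  have : Fintype (MulAction.orbitRel.Quotient G E) := Fintype.ofFinite _
  rw [Q.sum_inc_orbit k fun i => (Q.mult k i : ℂ)⁻¹ * ∑ j, Q.extendEdge F i j,
    MetricGraph.sum_inc_eq_sum_ite]
  have h1 : ∀ f : Q.Edge → ℂ, ∑ ε, f ε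
      = ∑ i, ∑ j : {j : Fin d // (j : ℕ) < Q.edgeDim i}, f ⟨i, j⟩ := fun f =>
    (Fintype.sum_equiv (ι := Q.Edge) (κ := Σ i : MulAction.orbitRel.Quotient G E,
      {j : Fin d // (j : ℕ) < Q.edgeDim i}) (Equiv.refl _) f f fun _ => rfl).trans
      (Fintype.sum_sigma _)
  rw [h1]
  refine Finset.sum_congr rfl fun i _ => ?_
  have h2 : ∀ j : {j : Fin d // (j : ℕ) < Q.edgeDim i},
      ((Q.quotient hG).src ⟨i, j⟩ = k ∨ (Q.quotient hG).tgt ⟨i, j⟩ = k) ↔ Q.mult k i ≠ 0 :=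
    fun j => (Q.inc_metricQuotient_iff hG k ⟨i, j⟩).trans (Q.mult_ne_zero_iff k i).symm
  simp only [h2]
  by_cases h : Q.mult k i = 0
  · simp [h]
  · rw [mul_inv_cancel_left₀ (Nat.cast_ne_zero.2 h)]
    simp only [ne_eq, h, not_false_eq_true, if_true]
    have h3 : ∀ j, Q.extendEdge F i j
        = if (j : ℕ) < Q.edgeDim i then Q.extendEdge F i j else 0 := fun j => by
      by_cases hj : (j : ℕ) < Q.edgeDim i <;> simp [extendEdge, hj]
    rw [Finset.sum_congr rfl fun j _ => h3 j, ← Finset.sum_filter,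
      Finset.sum_subtype _ (p := fun j : Fin d => (j : ℕ) < Q.edgeDim i) (by simp)]
    exact Finset.sum_congr rfl fun j _ => (Q.extendEdge_of_lt F j.2).symm

/-- Apart from these weights, this is the form of Γ applied to each basis index. Unequal weights are
the only possible obstruction in the Neumann case. -/
theorem boundaryForm_quotient (hU : ∀ (g : G) (i : MulAction.orbitRel.Quotient G E),
      LinearMap.toMatrix (Q.bE i) Q.b (ρ g) ∈ Matrix.unitaryGroup (Fin d) ℂ)
    (k : MulAction.orbitRel.Quotient G V) (X' Y' X Y : Q.Edge → ℂ) :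
    (Q.quotient hG).boundaryForm k X' Y' X Y = ∑ e : Γ.Inc (Q.vertRep k),
      (Q.mult k (Quotient.mk'' e.1) : ℂ)⁻¹ * (Q.dualInner (Q.lift k Y' e) (Q.lift k X e)
        - Q.dualInner (Q.lift k X' e) (Q.lift k Y e)) := by
  have h : ∀ X Y : Q.Edge → ℂ, ∑ ε : (Q.quotient hG).Inc k, conj (X ε.1) * Y ε.1
      = ∑ e : Γ.Inc (Q.vertRep k), (Q.mult k (Quotient.mk'' e.1) : ℂ)⁻¹
        * Q.dualInner (Q.lift k X e) (Q.lift k Y e) := by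
    intro X Y
    rw [Q.sum_inc_quotient hG k fun ε => conj (X ε) * Y ε]
    refine Finset.sum_congr rfl fun e _ => ?_
    rw [Q.dualInner_lift hU]
    congr 1
    refine Finset.sum_congr rfl fun j _ => ?_
    simp only [extendEdge]
    split_ifs <;> simp
  rw [QuantumGraph.boundaryForm, Finset.sum_sub_distrib, h, h, ← Finset.sum_sub_distrib]
  simp only [mul_sub]

end QuotientChoice

/-! ### Equivariant families and invariance under the vertex stabilizer -/

namespace QuantumGraph

variable {V E : Type*} {Γ : QuantumGraph V E}

theorem IsNeumann.bcInc_iff [Fintype E] (hN : Γ.IsNeumann) {v : V} {x y : Γ.Inc v → ℂ} :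
    Γ.BCInc v x y ↔ (∀ e e', x e = x e') ∧ ∑ e, y e = 0 := by
  obtain ⟨x, rfl⟩ := Γ.exists_eq_restrict_inc x
  obtain ⟨y, rfl⟩ := Γ.exists_eq_restrict_inc y
  exact hN v x y

section Equivariant

variable {G W : Type*} [Group G] [MulAction G V] [MulAction G E] [AddCommGroup W] [Module ℂ W]
  {ρ : Representation ℂ G W} {v : V} [Fintype E] (hG : Γ.IsAction G)
include hG

theorem IsAction.isInvariantFunctional_sum {ψ : Γ.Inc v → Module.Dual ℂ W}
    (hψ : IsEquivariant ρ ψ) :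
    IsInvariantFunctional ρ (MulAction.stabilizer G v) (∑ e, ψ e) := by
  intro g hg w
  have hg' := inv_mem hg
  let σ : Γ.Inc v ≃ Γ.Inc v :=
    { toFun := fun e => ⟨g • e.1, hG.smul_inc hg e⟩
      invFun := fun e => ⟨g⁻¹ • e.1, hG.smul_inc hg' e⟩
      left_inv := fun e => Subtype.ext (inv_smul_smul g e.1)
      right_inv := fun e => Subtype.ext (smul_inv_smul g e.1) }
  rw [LinearMap.sum_apply, LinearMap.sum_apply]
  exact (Fintype.sum_equiv σ _ _ fun e => (hψ g e (σ e) rfl w).symm).symm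

theorem IsAction.isInvariantFunctional_of_const {ψ : Γ.Inc v → Module.Dual ℂ W}
    (hψ : IsEquivariant ρ ψ) (hc : ∀ e e', ψ e = ψ e') (e : Γ.Inc v) :
    IsInvariantFunctional ρ (MulAction.stabilizer G v) (ψ e) := by
  intro g hg w
  let e' : Γ.Inc v := ⟨g • e.1, hG.smul_inc hg e⟩
  have h := hψ g e e' rfl w
  rwa [hc e' e] at h

/-- Multiples of an invariant functional, by factors depending on the orbits only, are
equivariant. -/
theorem IsAction.isEquivariant_smul {φ : Module.Dual ℂ W}
    (hφ : IsInvariantFunctional ρ (MulAction.stabilizer G v) φ)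
    (c : MulAction.orbitRel.Quotient G E → ℂ) :
    IsEquivariant ρ fun e : Γ.Inc v => c (Quotient.mk'' e.1) • φ := by
  intro g e e' h w
  have h1 : (Quotient.mk'' e'.1 : MulAction.orbitRel.Quotient G E) = Quotient.mk'' e.1 :=
    Quotient.sound' ⟨g, h⟩
  simp only [h1, LinearMap.smul_apply]
  rw [hφ g (hG.smul_eq_of_smul_inc e e' h)]

end Equivariant

end QuantumGraph

/-! ### When the condition at a quotient vertex is Lagrangian -/

namespace QuotientChoice

variable {V E G W : Type*} [Group G] [MulAction G V] [MulAction G E]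
    [AddCommGroup W] [Module ℂ W] {Γ : QuantumGraph V E} {ρ : Representation ℂ G W} {d : ℕ}
    (Q : QuotientChoice Γ ρ d)

theorem dualInner_sum_left {ι : Type*} (s : Finset ι) (φ : ι → Module.Dual ℂ W)
    (ψ : Module.Dual ℂ W) : Q.dualInner (∑ i ∈ s, φ i) ψ = ∑ i ∈ s, Q.dualInner (φ i) ψ := by
  simp only [dualInner, LinearMap.sum_apply, map_sum, Finset.sum_mul]
  exact Finset.sum_comm

theorem dualInner_sum_right {ι : Type*} (s : Finset ι) (φ : Module.Dual ℂ W)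
    (ψ : ι → Module.Dual ℂ W) : Q.dualInner φ (∑ i ∈ s, ψ i) = ∑ i ∈ s, Q.dualInner φ (ψ i) := by
  simp only [dualInner, LinearMap.sum_apply, Finset.mul_sum]
  exact Finset.sum_comm

theorem dualInner_smul_right (c : ℂ) (φ ψ : Module.Dual ℂ W) :
    Q.dualInner φ (c • ψ) = c * Q.dualInner φ ψ := by
  simp only [dualInner, LinearMap.smul_apply, smul_eq_mul, Finset.mul_sum]
  exact Finset.sum_congr rfl fun a _ => by ring

theorem dualInner_sub_right (φ ψ ψ' : Module.Dual ℂ W) :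
    Q.dualInner φ (ψ - ψ') = Q.dualInner φ ψ - Q.dualInner φ ψ' := by
  simp only [dualInner, LinearMap.sub_apply, mul_sub, Finset.sum_sub_distrib]

theorem dualInner_zero_left (ψ : Module.Dual ℂ W) : Q.dualInner 0 ψ = 0 := by
  simp [dualInner]

theorem dualInner_zero_right (φ : Module.Dual ℂ W) : Q.dualInner φ 0 = 0 := by
  simp [dualInner]

theorem dualInner_self (φ : Module.Dual ℂ W) :
    Q.dualInner φ φ = ((∑ a, Complex.normSq (φ (Q.b a)) : ℝ) : ℂ) := by
  simp [dualInner, Complex.normSq_eq_conj_mul_self]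

theorem eq_zero_of_sum_dualInner_self {ι : Type*} [Fintype ι] {m : ι → ℕ} (hm : ∀ i, m i ≠ 0)
    {φ : ι → Module.Dual ℂ W} (h : ∑ i, (m i : ℂ)⁻¹ * Q.dualInner (φ i) (φ i) = 0) (i : ι) :
    φ i = 0 := by
  have h1 : ∑ i, (m i : ℝ)⁻¹ * ∑ a, Complex.normSq (φ i (Q.b a)) = 0 := by
    rw [← Complex.ofReal_eq_zero, ← h]
    simp [dualInner_self]
  have h2 : ∀ i, 0 ≤ ∑ a, Complex.normSq (φ i (Q.b a)) :=
    fun i => Finset.sum_nonneg fun a _ => Complex.normSq_nonneg _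
  have h3 := (Finset.sum_eq_zero_iff_of_nonneg fun i _ =>
    mul_nonneg (inv_nonneg.2 (Nat.cast_nonneg (m i))) (h2 i)).1 h1 i (Finset.mem_univ i)
  have h4 := (mul_eq_zero.1 h3).resolve_left (inv_ne_zero (Nat.cast_ne_zero.2 (hm i)))
  refine Q.b.ext fun a => ?_
  have h5 := (Finset.sum_eq_zero_iff_of_nonneg fun a _ => Complex.normSq_nonneg _).1 h4 a
    (Finset.mem_univ a)
  simpa using h5

theorem eq_zero_of_dualInner_self {φ : Module.Dual ℂ W} (h : Q.dualInner φ φ = 0) : φ = 0 :=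
  Q.eq_zero_of_sum_dualInner_self (ι := Unit) (m := fun _ => 1) (by simp) (φ := fun _ => φ)
    (by simpa using h) ()

variable [Fintype E] (hG : Γ.IsAction G)

theorem mult_mk_ne_zero (k : MulAction.orbitRel.Quotient G V) (e : Γ.Inc (Q.vertRep k)) :
    Q.mult k (Quotient.mk'' e.1) ≠ 0 := (Q.mult_ne_zero_iff k _).2 ⟨e, rfl⟩

theorem isLagrangianAt_quotient_of_stabilizer_eq_bot [Finite G]
    (hU : ∀ (g : G) (i : MulAction.orbitRel.Quotient G E),
      LinearMap.toMatrix (Q.bE i) Q.b (ρ g) ∈ Matrix.unitaryGroup (Fin d) ℂ)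
    {k : MulAction.orbitRel.Quotient G V} (hL : Γ.IsLagrangianAt (Q.vertRep k))
    (hk : MulAction.stabilizer G (Q.vertRep k) = ⊥) : (Q.quotient hG).IsLagrangianAt k := by
  classical
  rw [QuantumGraph.isLagrangianAt_iff] at hL
  -- An element carrying an edge at ṽ_k to another one fixes ṽ_k, so it is 1: no two edges at ṽ_k
  -- share an orbit and equivariance is void.
  have hequiv : ∀ ψ : Γ.Inc (Q.vertRep k) → Module.Dual ℂ W, Γ.IsEquivariant ρ ψ := by
    intro ψ g e e' h w
    have hg : g ∈ MulAction.stabilizer G (Q.vertRep k) := hG.smul_eq_of_smul_inc e e' h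
    rw [hk, Subgroup.mem_bot] at hg
    subst hg
    rw [one_smul] at h
    rw [Subtype.ext h, map_one]; rfl
  have hmult : ∀ e : Γ.Inc (Q.vertRep k), Q.mult k (Quotient.mk'' e.1) = 1 := fun e => by
    have := hG.card_inc_orbit_mul_card_stabilizer e
    rw [hk, Subgroup.card_bot] at this
    exact Nat.eq_one_of_mul_eq_one_right this
  have hform : ∀ X' Y' X Y, (Q.quotient hG).boundaryForm k X' Y' X Y = ∑ a, ∑ e,
      (conj (Q.lift k Y' e (Q.b a)) * Q.lift k X e (Q.b a)
        - conj (Q.lift k X' e (Q.b a)) * Q.lift k Y e (Q.b a)) := by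
    intro X' Y' X Y
    rw [Q.boundaryForm_quotient hG hU, Finset.sum_comm]
    simp [hmult, dualInner]
  intro X Y
  constructor
  · intro h X' Y' h'
    rw [bc_quotient_iff] at h h'
    rw [hform]
    exact Finset.sum_eq_zero fun a _ => (hL _ _).1 (h a) _ _ (h' a)
  · intro h
    rw [bc_quotient_iff]
    intro a
    rw [hL]
    intro x' y' hxy'
    -- Multiples of the a-th dual basis vector isolate the a-th copy of the condition of Γ.
    obtain ⟨X', hX'⟩ := Q.exists_lift_eq (hequiv fun e => x' e • Q.b.coord a)
    obtain ⟨Y', hY'⟩ := Q.exists_lift_eq (hequiv fun e => y' e • Q.b.coord a)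
    have h1 := h X' Y' <| by
      rw [bc_quotient_iff, hX', hY']
      intro a'
      by_cases ha : a' = a
      · subst ha; simpa using hxy'
      · have : (fun _ : Γ.Inc (Q.vertRep k) => (0 : ℂ)) = 0 := rfl
        simp [ha, QuantumGraph.BCInc, this]
    rw [hform, Finset.sum_eq_single a, hX', hY'] at h1
    · simpa using h1
    · intro a' _ ha
      simp [hX', hY', ha]
    · simp

theorem bc_quotient_iff_of_isNeumann (hN : Γ.IsNeumann) (k : MulAction.orbitRel.Quotient G V)
    (X Y : Q.Edge → ℂ) : (Q.quotient hG).BC k X Y ↔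
      (∀ e e', Q.lift k X e = Q.lift k X e') ∧ ∑ e, Q.lift k Y e = 0 := by
  simp only [bc_quotient_iff, hN.bcInc_iff, forall_and]
  refine and_congr ⟨fun h e e' => Q.b.ext fun a => h a e e', fun h a e e' => by rw [h e e']⟩
    ⟨fun h => Q.b.ext fun a => ?_, fun h a => ?_⟩
  · simpa using h a
  · simpa using LinearMap.congr_fun h (Q.b a)

section Neumann

variable [Finite G] (hN : Γ.IsNeumann)
  (hU : ∀ (g : G) (i : MulAction.orbitRel.Quotient G E),
    LinearMap.toMatrix (Q.bE i) Q.b (ρ g) ∈ Matrix.unitaryGroup (Fin d) ℂ)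
  {k : MulAction.orbitRel.Quotient G V}
include hN hU

/-- A constant equivariant family and the sum of any equivariant family are invariant under G_ṽ,
hence zero here. Only the Dirichlet condition remains. -/
theorem isLagrangianAt_quotient_of_forall_invariant_eq_zero
    (h0 : ∀ ψ : Module.Dual ℂ W,
      IsInvariantFunctional ρ (MulAction.stabilizer G (Q.vertRep k)) ψ → ψ = 0) :
    (Q.quotient hG).IsLagrangianAt k := by
  have hbc : ∀ X Y, (Q.quotient hG).BC k X Y ↔ ∀ e, Q.lift k X e = 0 := by
    intro X Y
    rw [Q.bc_quotient_iff_of_isNeumann hG hN]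
    exact ⟨fun h e => h0 _ (hG.isInvariantFunctional_of_const (Q.isEquivariant_lift k X) h.1 e),
      fun h => ⟨fun e e' => by rw [h, h],
        h0 _ (hG.isInvariantFunctional_sum (Q.isEquivariant_lift k Y))⟩⟩
  intro X Y
  simp only [hbc, Q.boundaryForm_quotient hG hU]
  constructor
  · intro h X' Y' h'
    simp [h, h', dualInner_zero_left, dualInner_zero_right]
  · intro h
    obtain ⟨X', hX'⟩ := Q.exists_lift_eq (k := k) (ψ := fun _ => (0 : Module.Dual ℂ W))
      fun _ _ _ _ _ => rfl
    -- Zero values with derivative data X satisfy the condition and pair with (X, Y) to the weighted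
    -- square norm of the lift of X.
    have h1 := h X' X fun e => by rw [hX']
    simp only [hX', dualInner_zero_left, sub_zero] at h1
    exact Q.eq_zero_of_sum_dualInner_self (Q.mult_mk_ne_zero k) h1

/-- A common weight may be dropped; among equivariant families, the constant ones and those with sum
zero are then orthogonal complements. -/
theorem isLagrangianAt_quotient_of_mult_eq {m : ℕ}
    (hm : ∀ e : Γ.Inc (Q.vertRep k), Q.mult k (Quotient.mk'' e.1) = m) :
    (Q.quotient hG).IsLagrangianAt k := by
  rcases isEmpty_or_nonempty (Γ.Inc (Q.vertRep k)) with hE | ⟨⟨e₀⟩⟩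
  · intro X Y
    simp [Q.bc_quotient_iff_of_isNeumann hG hN, Q.boundaryForm_quotient hG hU]
  have hm0 : (m : ℂ)⁻¹ ≠ 0 :=
    inv_ne_zero (Nat.cast_ne_zero.2 (hm e₀ ▸ Q.mult_mk_ne_zero k e₀))
  have hform : ∀ X' Y' X Y, (Q.quotient hG).boundaryForm k X' Y' X Y = 0 ↔
      ∑ e, Q.dualInner (Q.lift k Y' e) (Q.lift k X e)
        - ∑ e, Q.dualInner (Q.lift k X' e) (Q.lift k Y e) = 0 := by
    intro X' Y' X Y
    rw [Q.boundaryForm_quotient hG hU, ← Finset.sum_sub_distrib]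
    simp only [hm, ← Finset.mul_sum]
    simp [hm0]
  obtain ⟨Z, hZ⟩ := Q.exists_lift_eq (k := k) (ψ := fun _ => (0 : Module.Dual ℂ W))
    fun _ _ _ _ _ => rfl
  intro X Y
  constructor
  · intro h X' Y' h'
    rw [Q.bc_quotient_iff_of_isNeumann hG hN] at h h'
    rw [hform, Finset.sum_congr rfl fun e _ => congrArg (Q.dualInner (Q.lift k Y' e)) (h.1 e e₀),
      Finset.sum_congr rfl fun e _ => congrArg (Q.dualInner · (Q.lift k Y e)) (h'.1 e e₀),
      ← Q.dualInner_sum_left, ← Q.dualInner_sum_right, h.2, h'.2, dualInner_zero_left, dualInner_zero_right, sub_zero]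
  · intro h
    rw [Q.bc_quotient_iff_of_isNeumann hG hN]
    constructor
    · let n : ℂ := Fintype.card (Γ.Inc (Q.vertRep k))
      have hn : n ≠ 0 := Nat.cast_ne_zero.2 (Fintype.card_pos_iff.2 ⟨e₀⟩).ne'
      let S : Module.Dual ℂ W := ∑ e, Q.lift k X e
      -- The deviation of X from its mean, multiplied by n: it is equivariant and has sum zero, so
      -- it is an admissible derivative. Being orthogonal to X and to constants, it is orthogonal to
      -- itself and vanishes.
      have hη : Γ.IsEquivariant ρ fun e : Γ.Inc (Q.vertRep k) => n • Q.lift k X e - S := by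
        intro g e e' hg w
        have h1 := Q.isEquivariant_lift k X g e e' hg w
        have h2 := hG.isInvariantFunctional_sum (Q.isEquivariant_lift k X) g
          (hG.smul_eq_of_smul_inc e e' hg) w
        simp only [LinearMap.sub_apply, LinearMap.smul_apply, h1, S, h2]
      obtain ⟨Y', hY'⟩ := Q.exists_lift_eq hη
      have hsum : ∑ e, Q.lift k Y' e = 0 := by
        simp only [hY', Finset.sum_sub_distrib, ← Finset.smul_sum, Finset.sum_const,
          Finset.card_univ, ← Nat.cast_smul_eq_nsmul ℂ]
        exact sub_self _
      have h1 := h Z Y' <| by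
        rw [Q.bc_quotient_iff_of_isNeumann hG hN]
        exact ⟨fun e e' => by rw [hZ], hsum⟩
      rw [hform] at h1
      simp only [hZ, dualInner_zero_left, Finset.sum_const_zero, sub_zero] at h1
      have h2 : ∑ e, Q.dualInner (Q.lift k Y' e) (Q.lift k Y' e) = 0 := by
        have h3 : ∀ e, Q.dualInner (Q.lift k Y' e) (Q.lift k Y' e)
            = n * Q.dualInner (Q.lift k Y' e) (Q.lift k X e) - Q.dualInner (Q.lift k Y' e) S :=
          fun e => by
            rw [← Q.dualInner_smul_right, ← Q.dualInner_sub_right]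
            exact congrArg (Q.dualInner (Q.lift k Y' e)) (congrFun hY' e)
        simp only [h3, Finset.sum_sub_distrib, ← Finset.mul_sum, h1, ← dualInner_sum_left, hsum,
          dualInner_zero_left, mul_zero, sub_zero]
      have h4 := Q.eq_zero_of_sum_dualInner_self (m := fun _ => 1) (by simp) (by simpa using h2)
      intro e e'
      have h5 : n • Q.lift k X e = n • Q.lift k X e' := by
        rw [sub_eq_zero.1 ((congrFun hY' e).symm.trans (h4 e)),
          sub_eq_zero.1 ((congrFun hY' e').symm.trans (h4 e'))]
      exact smul_right_injective _ hn h5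
    · have hS := hG.isInvariantFunctional_sum (Q.isEquivariant_lift k Y)
      -- The constant family with value S = ∑ Yₑ is admissible as values, and pairing it with Y
      -- gives the square norm of S up to sign.
      obtain ⟨X', hX'⟩ := Q.exists_lift_eq (by simpa using hG.isEquivariant_smul hS fun _ => 1)
      have h1 := h X' Z <| by
        rw [Q.bc_quotient_iff_of_isNeumann hG hN]
        exact ⟨fun e e' => by rw [hX'], by simp [hZ]⟩
      rw [hform] at h1
      simp only [hZ, hX', dualInner_zero_left, Finset.sum_const_zero, zero_sub, neg_eq_zero,
        ← dualInner_sum_right] at h1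
      exact Q.eq_zero_of_dualInner_self h1

theorem mult_eq_of_isLagrangianAt_quotient (hL : (Q.quotient hG).IsLagrangianAt k)
    {φ : Module.Dual ℂ W}
    (hφ : IsInvariantFunctional ρ (MulAction.stabilizer G (Q.vertRep k)) φ) (hφ0 : φ ≠ 0)
    (e₁ e₂ : Γ.Inc (Q.vertRep k)) :
    Q.mult k (Quotient.mk'' e₁.1) = Q.mult k (Quotient.mk'' e₂.1) := by
  classical
  have : Finite (MulAction.orbitRel.Quotient G E) := Quotient.finite _
  have : Fintype (MulAction.orbitRel.Quotient G E) := Fintype.ofFinite _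
  let i₁ : MulAction.orbitRel.Quotient G E := Quotient.mk'' e₁.1
  let i₂ : MulAction.orbitRel.Quotient G E := Quotient.mk'' e₂.1
  -- The family cₑ φ satisfies ∑ cₑ/mₑ = 0, so it is orthogonal to constants in the weighted form.
  -- The Lagrangian property forces ∑ cₑ φ = 0, that is, m₁ = m₂.
  let c : MulAction.orbitRel.Quotient G E → ℂ := Pi.single i₁ 1 - Pi.single i₂ 1
  obtain ⟨Z, hZ⟩ := Q.exists_lift_eq (k := k) (ψ := fun _ => (0 : Module.Dual ℂ W))
    fun _ _ _ _ _ => rfl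
  obtain ⟨Y, hY⟩ := Q.exists_lift_eq (hG.isEquivariant_smul hφ c)
  have h1 : (Q.quotient hG).BC k Z Y := by
    rw [hL]
    intro X' Y' h'
    rw [Q.bc_quotient_iff_of_isNeumann hG hN] at h'
    rw [Q.boundaryForm_quotient hG hU]
    simp only [hZ, hY, dualInner_zero_right, zero_sub, dualInner_smul_right]
    rw [Finset.sum_congr rfl fun e _ => by rw [h'.1 e e₁],
      Q.sum_inc_orbit k fun i => (Q.mult k i : ℂ)⁻¹ * -(c i * Q.dualInner (Q.lift k X' e₁) φ)]
    have h2 : ∀ i, (Q.mult k i : ℂ) * ((Q.mult k i : ℂ)⁻¹ * -(c i * Q.dualInner (Q.lift k X' e₁) φ))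
        = -(c i * Q.dualInner (Q.lift k X' e₁) φ) := by
      intro i
      -- For orbits not meeting ṽ_k the weight is 0⁻¹ = 0, and the identity holds because c vanishes
      -- there.
      by_cases hi : Q.mult k i = 0
      · have hne : ∀ e : Γ.Inc (Q.vertRep k), i ≠ Quotient.mk'' e.1 := fun e he =>
          Q.mult_mk_ne_zero k e (he ▸ hi)
        have : c i = 0 := by simp [c, i₁, i₂, hne]
        simp [this]
      · rw [mul_inv_cancel_left₀ (Nat.cast_ne_zero.2 hi)]
    simp only [h2, Finset.sum_neg_distrib, ← Finset.sum_mul]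
    simp [c]
  have h2 := ((Q.bc_quotient_iff_of_isNeumann hG hN k Z Y).1 h1).2
  simp only [hY, ← Finset.sum_smul] at h2
  have h3 := (smul_eq_zero.1 h2).resolve_right hφ0
  rw [Q.sum_inc_orbit k c] at h3
  simp only [c, Pi.sub_apply, mul_sub, Finset.sum_sub_distrib, Pi.single_apply, mul_ite, mul_one,
    mul_zero, Finset.sum_ite_eq', Finset.mem_univ, if_true, sub_eq_zero, Nat.cast_inj] at h3
  exact h3

theorem isLagrangianAt_quotient_iff_of_isNeumann [FiniteDimensional ℂ W] :
    (Q.quotient hG).IsLagrangianAt k ↔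
      charInner (MulAction.stabilizer G (Q.vertRep k)) ρ.character (fun _ => 1) = 0 ∨
      ∀ e e' : Γ.Inc (Q.vertRep k), Nat.card (MulAction.stabilizer G e.1)
        = Nat.card (MulAction.stabilizer G e'.1) := by
  have hcard := fun e : Γ.Inc (Q.vertRep k) => hG.card_inc_orbit_mul_card_stabilizer e
  rw [charInner_one_eq_zero_iff]
  constructor
  · intro hL
    refine or_iff_not_imp_left.2 fun h e e' => ?_
    push Not at h
    obtain ⟨φ, hφ, hφ0⟩ := h
    have h1 := Q.mult_eq_of_isLagrangianAt_quotient hG hN hU hL hφ hφ0 e e'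
    have h2 := (hcard e).trans (hcard e').symm
    change Q.mult k _ * _ = Q.mult k _ * _ at h2
    rw [h1] at h2
    exact Nat.eq_of_mul_eq_mul_left (Nat.pos_of_ne_zero (Q.mult_mk_ne_zero k e')) h2
  · rintro (h | h)
    · exact Q.isLagrangianAt_quotient_of_forall_invariant_eq_zero hG hN hU h
    · rcases isEmpty_or_nonempty (Γ.Inc (Q.vertRep k)) with hE | ⟨⟨e₀⟩⟩
      -- At an isolated vertex any m will do.
      · exact Q.isLagrangianAt_quotient_of_mult_eq hG hN hU (m := 0) fun e => hE.elim e
      · refine Q.isLagrangianAt_quotient_of_mult_eq hG hN hU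
          (m := Q.mult k (Quotient.mk'' e₀.1)) fun e => ?_
        have h2 := (hcard e).trans (hcard e₀).symm
        change Q.mult k _ * _ = Q.mult k _ * _ at h2
        rw [h e e₀] at h2
        exact Nat.eq_of_mul_eq_mul_right Nat.card_pos h2

end Neumann

end QuotientChoice

/-! ### From orbit representatives to all vertices -/

theorem charInner_stabilizer_smul_eq_zero {V G W : Type*} [Group G] [Finite G] [MulAction G V]
    [AddCommGroup W] [Module ℂ W] [FiniteDimensional ℂ W] (ρ : Representation ℂ G W) (g : G) {v : V}
    (h : charInner (MulAction.stabilizer G v) ρ.character (fun _ => 1) = 0) :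
    charInner (MulAction.stabilizer G (g • v)) ρ.character (fun _ => 1) = 0 := by
  rw [charInner_one_eq_zero_iff] at h ⊢
  intro ψ hψ
  have h1 := h (ψ ∘ₗ ρ g) fun s hs w => by
    have h2 : g * s * g⁻¹ ∈ MulAction.stabilizer G (g • v) := by
      rw [MulAction.mem_stabilizer_iff, mul_smul, inv_smul_smul, mul_smul,
        MulAction.mem_stabilizer_iff.1 hs]
    have h3 := hψ _ h2 (ρ g w)
    rwa [← Module.End.mul_apply, ← map_mul, inv_mul_cancel_right, map_mul,
      Module.End.mul_apply] at h3
  ext w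
  have := LinearMap.congr_fun h1 (ρ g⁻¹ w)
  simpa using this

theorem QuantumGraph.IsAction.card_stabilizer_inc_smul {V E G : Type*} [Fintype E] [Group G]
    [MulAction G V] [MulAction G E] {Γ : QuantumGraph V E} (hG : Γ.IsAction G) (g : G) {v : V}
    (h : ∀ e e' : Γ.Inc v, Nat.card (MulAction.stabilizer G e.1)
      = Nat.card (MulAction.stabilizer G e'.1)) (e e' : Γ.Inc (g • v)) :
    Nat.card (MulAction.stabilizer G e.1) = Nat.card (MulAction.stabilizer G e'.1) := by
  have key : ∀ e : Γ.Inc (g • v), ∃ e' : Γ.Inc v,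
      Nat.card (MulAction.stabilizer G e.1) = Nat.card (MulAction.stabilizer G e'.1) := by
    intro e
    have h1 := hG.src_or_tgt_smul (g := g⁻¹) e.2
    rw [inv_smul_smul] at h1
    exact ⟨⟨_, h1⟩, Nat.card_congr
      (MulAction.stabilizerEquivStabilizerOfOrbitRel ⟨g, smul_inv_smul g e.1⟩).toEquiv⟩
  obtain ⟨f, hf⟩ := key e
  obtain ⟨f', hf'⟩ := key e'
  rw [hf, hf', h]

end

theorem mainTheorem6 {V E G W : Type*} [Fintype V] [Fintype E] [Group G] [Finite G]
    [MulAction G V] [MulAction G E] [AddCommGroup W] [Module ℂ W] [FiniteDimensional ℂ W]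
    (Γ : QuantumGraph V E) (hG : Γ.IsAction G) (ρ : Representation ℂ G W) (d : ℕ)
    (Q : QuotientChoice Γ ρ d)
    (hU : ∀ (g : G) (i : MulAction.orbitRel.Quotient G E),
      LinearMap.toMatrix (Q.bE i) Q.b (ρ g) ∈ Matrix.unitaryGroup (Fin d) ℂ) :
    (IsSelfAdjoint Γ.laplacian →
      (∀ (g : G) (e : E), g • e = e → g = 1) →
      (∀ (g : G) (v : V), g • v = v → g = 1) →
      IsSelfAdjoint (Q.quotient hG).laplacian) ∧
    (Γ.IsNeumann →
      (IsSelfAdjoint (Q.quotient hG).laplacian ↔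
        ∀ v : V,
          charInner (MulAction.stabilizer G v) ρ.character (fun _ => 1) = 0 ∨
          ∀ e e' : Γ.Inc v, Nat.card (MulAction.stabilizer G e.1)
            = Nat.card (MulAction.stabilizer G e'.1))) := by
  have : Finite (MulAction.orbitRel.Quotient G V) := Quotient.finite _
  have : Fintype (MulAction.orbitRel.Quotient G V) := Fintype.ofFinite _
  rw [QuantumGraph.isSelfAdjoint_laplacian_iff, QuantumGraph.isSelfAdjoint_laplacian_iff]
  constructor
  · intro hL _ hV k
    refine Q.isLagrangianAt_quotient_of_stabilizer_eq_bot hG hU (hL _) ?_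
    exact (Subgroup.eq_bot_iff_forall _).2 fun g hg => hV g _ hg
  · intro hN
    simp only [Q.isLagrangianAt_quotient_iff_of_isNeumann hG hN hU]
    refine ⟨fun h v => ?_, fun h k => h _⟩
    -- The quotient sees only the representatives; both alternatives are constant along orbits since
    -- stabilizers there are conjugate.
    obtain ⟨g, hg⟩ := Quotient.eq''.1 (Q.vertRep_spec (Quotient.mk'' v)).symm
    rw [← hg]
    exact (h (Quotient.mk'' v)).imp (charInner_stabilizer_smul_eq_zero ρ g)
      (hG.card_stabilizer_inc_smul g)
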